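/- **Setting.** For a probability $F$ on $\mathbb R$ put $$\mathcal I_F^{\rm loc}=\sup_{\varphi}\frac{(\int\varphi'\,dF)^2}{\int\varphi^2\,dF},\qquad \mathcal I_F^{\rm sc}=\sup_{\varphi}\frac{(\int v\,\varphi'(v)\,F(dv))^2}{\int\varphi^2\,dF},$$ the suprema being over all $C^1$ functions $\varphi$ of compact support, respectively over all $C^1$ functions $\varphi$ whose derivative has compact support (with $0/0=0$ and $c/0=\infty$ for $c>0$). Consider the following models with error distribution $F$, parameter $\theta\in\mathbb R^k$ (held fixed) and Fisher information $\mathcal I_{F,\theta}$. * *Location* ($k=1$): $y_i=\theta+v_i$, $v_i$ i.i.d. $\sim F$; $\mathcal I_{F,\theta}=\mathcal I_F^{\rm loc}$. * *Scale* ($k=1$): $y_i=\theta v_i$, $\theta>0$, $v_i$ i.i.d. $\sim F$; $\mathcal I_{F,\theta}=\mathcal I_F^{\rm sc}/\theta^2$. * *Linear regression*: observations $(x_i,y_i)$ with $y_i=x_i'\theta+v_i$, where the pairs $(x_i,v_i)$ are i.i.d. $\sim K\otimes F$, and $K$ is a probability on $\mathbb R^k$ with finite second moments and $\int xx'\,K(dx)>0$;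 $\mathcal I_{F,\theta}=\mathcal I_F^{\rm loc}\int xx'\,K(dx)$. * *MA($q$), AR($p$), ARMA($p,q$)*: observations $X_1,\dots,X_n$ of the stationary process $\phi(B)X_t=\xi(B)V_t$, $t\in\mathbb Z$, where $B$ is the backshift operator, $V_t$ are i.i.d. $\sim F$, $\phi(z)=1+\sum_{j\le p}\phi_jz^j$, $\xi(z)=1+\sum_{j\le q}\xi_jz^j$ are real and relatively prime, $\phi_p\xi_q\neq0$, and $\phi(z)\xi(z)\ne0$ for all complex $|z|\le1$ (MA: $p=0$; AR: $q=0$); $\theta=(\phi_1,\dots,\phi_p,\xi_1,\dots,\xi_q)$, $k=p+q$, and $\mathcal I_{F,\theta}=\mathcal I_F^{\rm loc}\,\sigma_F^2\,\mathcal K_\theta$, where $\sigma_F^2\mathcal K_\theta$ is the covariance matrix of $H_1=\bigl(-B\phi^{-1}(B),\dots,-B^p\phi^{-1}(B);\,B\xi^{-1}(B),\dots,B^q\xi^{-1}(B)\bigr)'V_1$. Call $F$ *regular* if $\mathcal I_F^{\rm loc}<\infty$ ($\mathcal I_F^{\rm sc}<\infty$ in the scale model) and, in the cases MA, AR, ARMA,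 in addition $\mu_F=\int v\,F(dv)=0$ and $\sigma_F^2=\int v^2\,F(dv)\in(0,\infty)$. For regular $F$ and $\varepsilon\in[0,1]$ let $$B_c^{s,i}(F,\varepsilon)=\bigl\{(1-s)F+sH \;\bigm|\; 0\le s\le\varepsilon,\ H \text{ regular and symmetric about }0\bigr\}.$$ Let $d_\kappa$ denote the Kolmogorov metric, i.e. the sup-norm distance between c.d.f.'s on $\mathbb R^k$. **Theorem.** In any of these models let $F$ be regular, and for each $n$ let $S_n$ be an estimator, i.e. a measurable $\mathbb R^k$-valued function of the $n$ observations; in the cases AR and ARMA ($p\ge1$) the functions $S_n$ are required to be continuous. If $\mathcal L_{F,\theta}\{(n\,\mathcal I_{F,\theta})^{1/2}(S_n-\theta)\}\to\mathcal N(0,\mathbb I_k)$ weakly, then for all $\varepsilon_n\in(0,1]$ with $\varepsilon_n\to0$, $$\liminf_{n\to\infty}\ \sup_{G\in B_c^{s,i}(F,\varepsilon_n)} d_\kappa\Bigl(\mathcal L_{G,\theta}\bigl\{(n\,\mathcal I_{G,\theta})^{1/2}(S_n-\theta)\bigr\},\ \mathcal N(0,\mathbb I_k)\Bigr)\ \ge\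 1-\frac1{2^k}.$$ If $F$ is symmetric about $0$, the same holds with $B_c^{s,i}(F,\varepsilon_n)$ replaced by the set of all $(1-\varepsilon_n)F+\varepsilon_nH$ with $H$ regular and symmetric about $0$. -/

import Mathlib

open MeasureTheory ProbabilityTheory Filter Topology Set
open scoped ENNReal MatrixOrder

noncomputable section

/-! ### Fisher information of the error distribution -/

/-- Fisher information of location of `F`: the supremum of `(∫ φ' dF)² / ∫ φ² dF` over all
continuously differentiable functions `φ` of compact support. It takes values in `[0, ∞]`,
with the conventions `0 / 0 = 0` and `c / 0 = ∞` for `c > 0`. -/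
def fisherInfoLoc (F : ProbabilityMeasure ℝ) : ℝ≥0∞ :=
  ⨆ (φ : ℝ → ℝ) (_ : ContDiff ℝ 1 φ) (_ : HasCompactSupport φ),
    ENNReal.ofReal ((∫ v, deriv φ v ∂(F : Measure ℝ)) ^ 2) /
      ENNReal.ofReal (∫ v, φ v ^ 2 ∂(F : Measure ℝ))

/-- Fisher information of scale of `F`: the supremum of `(∫ v φ'(v) F(dv))² / ∫ φ² dF` over all
functions `φ` having a continuous derivative of compact support. -/
def fisherInfoScale (F : ProbabilityMeasure ℝ) : ℝ≥0∞ :=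
  ⨆ (φ : ℝ → ℝ) (_ : ContDiff ℝ 1 φ) (_ : HasCompactSupport (deriv φ)),
    ENNReal.ofReal ((∫ v, v * deriv φ v ∂(F : Measure ℝ)) ^ 2) /
      ENNReal.ofReal (∫ v, φ v ^ 2 ∂(F : Measure ℝ))

/-! ### Kolmogorov distance and the standard normal law -/

/-- The standard normal law `N(0, I_k)` on `ℝ^k`, where `k` is the cardinality of `ι`. -/
def stdNormal (ι : Type) [Fintype ι] : Measure (ι → ℝ) :=
  Measure.pi fun _ : ι => gaussianReal 0 1

instance (ι : Type) [Fintype ι] : IsProbabilityMeasure (stdNormal ι) := by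
  unfold stdNormal; infer_instance

/-- Kolmogorov distance: the sup-norm distance between the cumulative distribution functions
`x ↦ μ {y | ∀ i, y i ≤ x i}` on `ℝ^k`. -/
def kolmogorovDist {ι : Type} (μ ν : Measure (ι → ℝ)) : ℝ≥0∞ :=
  ⨆ x : ι → ℝ, ENNReal.ofReal |μ.real (Iic x) - ν.real (Iic x)|

/-! ### Models -/

/-- A model at a fixed parameter value, with the error (innovation) distribution left variable:
the parameter value `θ`, the class of error distributions having the required finite Fisher
information (and moments), the Fisher information matrix `I_{F,θ}` of the model, and the joint
law of `n` observations. -/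
structure ErrorModel (ι Y : Type) [MeasurableSpace Y] where
  /-- the parameter value -/
  param : ι → ℝ
  /-- the regular error distributions -/
  errors : Set (ProbabilityMeasure ℝ)
  /-- the Fisher information matrix -/
  info : ProbabilityMeasure ℝ → Matrix ι ι ℝ
  /-- the joint law of `n` observations -/
  law : ProbabilityMeasure ℝ → (n : ℕ) → ProbabilityMeasure (Fin n → Y)

/-- Location: `y_i = θ + v_i`, with `v_i` i.i.d. `∼ F`. -/
def locationModel (θ : ℝ) : ErrorModel (Fin 1) ℝ where
  param := fun _ => θ
  errors := {F | fisherInfoLoc F < ∞}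
  info F := (fisherInfoLoc F).toReal • (1 : Matrix (Fin 1) (Fin 1) ℝ)
  law F n := ProbabilityMeasure.pi fun _ : Fin n =>
    F.map (f := fun v => θ + v) (by fun_prop)

/-- Scale: `y_i = σ v_i`, with `v_i` i.i.d. `∼ F`. -/
def scaleModel (σ : ℝ) : ErrorModel (Fin 1) ℝ where
  param := fun _ => σ
  errors := {F | fisherInfoScale F < ∞}
  info F := (fisherInfoScale F).toReal • ((σ ^ 2)⁻¹ • (1 : Matrix (Fin 1) (Fin 1) ℝ))
  law F n := ProbabilityMeasure.pi fun _ : Fin n =>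
    F.map (f := fun v => σ * v) (by fun_prop)

/-- The matrix `∫ x x' K(dx)` of second moments of the regressor. -/
def secondMoment {d : ℕ} (K : ProbabilityMeasure (Fin d → ℝ)) : Matrix (Fin d) (Fin d) ℝ :=
  Matrix.of fun i j => ∫ x, x i * x j ∂(K : Measure (Fin d → ℝ))

/-- Linear regression with observations `(x_i, y_i)`, `y_i = x_i'θ + v_i`, where the pairs
`(x_i, v_i)` are i.i.d. `∼ K ⊗ F`. -/
def regressionModel {d : ℕ} (K : ProbabilityMeasure (Fin d → ℝ)) (θ : Fin d → ℝ) :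
    ErrorModel (Fin d) ((Fin d → ℝ) × ℝ) where
  param := θ
  errors := {F | fisherInfoLoc F < ∞}
  info F := (fisherInfoLoc F).toReal • secondMoment K
  law F n := ProbabilityMeasure.pi fun _ : Fin n =>
    (K.prod F).map (f := fun z => (z.1, z.1 ⬝ᵥ θ + z.2))
      (by unfold dotProduct; fun_prop)

/-- The polynomial `1 + a₁ z + ⋯ + a_p z^p`. -/
def lagPoly {p : ℕ} (a : Fin p → ℝ) : Polynomial ℝ :=
  1 + ∑ i : Fin p, Polynomial.C (a i) * Polynomial.X ^ (i.val + 1)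

/-- The power series expansion of `1 / (1 + a₁ z + ⋯ + a_p z^p)`. -/
def lagInv {p : ℕ} (a : Fin p → ℝ) : PowerSeries ℝ :=
  (lagPoly a : PowerSeries ℝ)⁻¹

/-- The standing assumptions on the coefficients of an ARMA(`p`,`q`) process: stationarity and
invertibility, `φ` and `ξ` are relatively prime, and `φ_p ξ_q ≠ 0` (where `φ_0 = ξ_0 = 1`). -/
def ArmaRegular {p q : ℕ} (φ : Fin p → ℝ) (ξ : Fin q → ℝ) : Prop :=
  (∀ z : ℂ, ‖z‖ ≤ 1 → Polynomial.aeval z (lagPoly φ) * Polynomial.aeval z (lagPoly ξ) ≠ 0) ∧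
  IsCoprime (lagPoly φ) (lagPoly ξ) ∧
  (lagPoly φ).coeff p * (lagPoly ξ).coeff q ≠ 0

/-- The stationary solution `X_t = φ⁻¹(B) ξ(B) V_t` of the ARMA equation `φ(B) X_t = ξ(B) V_t`,
`t ∈ ℤ`, where `B` is the backshift operator, as a function of the innovations `v = (v_t)`. -/
def armaProcess {p q : ℕ} (φ : Fin p → ℝ) (ξ : Fin q → ℝ) (t : ℤ) (v : ℤ → ℝ) : ℝ :=
  ∑' j : ℕ, PowerSeries.coeff j (lagInv φ * (lagPoly ξ : PowerSeries ℝ)) * v (t - j)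

lemma measurable_armaProcess {p q : ℕ} (φ : Fin p → ℝ) (ξ : Fin q → ℝ) (t : ℤ) :
    Measurable (armaProcess φ ξ t) := by
  unfold armaProcess
  exact Measurable.tsum fun j => by fun_prop

/-- The power series by which the transition scores `H₁` are obtained from the innovations:
`-B^j φ⁻¹(B)` for `j = 1, …, p` and `B^j ξ⁻¹(B)` for `j = 1, …, q`. -/
def scoreFilter {p q : ℕ} (φ : Fin p → ℝ) (ξ : Fin q → ℝ) : Fin p ⊕ Fin q → PowerSeries ℝ
  | Sum.inl i => -(PowerSeries.X ^ (i.val + 1) * lagInv φ)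
  | Sum.inr i => PowerSeries.X ^ (i.val + 1) * lagInv ξ

/-- The matrix `𝒦_θ = Cov(H₁) / σ_F²`, which does not depend on `F`. -/
def armaMatrix {p q : ℕ} (φ : Fin p → ℝ) (ξ : Fin q → ℝ) :
    Matrix (Fin p ⊕ Fin q) (Fin p ⊕ Fin q) ℝ :=
  Matrix.of fun a b => ∑' m : ℕ,
    PowerSeries.coeff m (scoreFilter φ ξ a) * PowerSeries.coeff m (scoreFilter φ ξ b)

/-- ARMA(`p`,`q`), with observations `X_1, …, X_n` of the stationary process
`φ(B) X_t = ξ(B) V_t`, where the innovations `V_t`, `t ∈ ℤ`, are i.i.d. `∼ F`, and parameter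
`(φ_1, …, φ_p, ξ_1, …, ξ_q)`. The cases `p = 0` and `q = 0` are MA(`q`) and AR(`p`).
Here `I_{F,θ} = I_F^loc σ_F² 𝒦_θ`. -/
def armaModel {p q : ℕ} (φ : Fin p → ℝ) (ξ : Fin q → ℝ) : ErrorModel (Fin p ⊕ Fin q) ℝ where
  param := Sum.elim φ ξ
  errors := {F | fisherInfoLoc F < ∞ ∧ MemLp id 2 (F : Measure ℝ) ∧
    ∫ v, v ∂(F : Measure ℝ) = 0 ∧ 0 < ∫ v, v ^ 2 ∂(F : Measure ℝ)}
  info F := ((fisherInfoLoc F).toReal * ∫ v, v ^ 2 ∂(F : Measure ℝ)) • armaMatrix φ ξ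
  law F n :=
    ProbabilityMeasure.map
      (⟨Measure.infinitePi fun _ : ℤ => (F : Measure ℝ), inferInstance⟩ :
        ProbabilityMeasure (ℤ → ℝ))
      (f := fun v (i : Fin n) => armaProcess φ ξ ((i.val : ℤ) + 1) v)
      (measurable_pi_lambda _ fun _ => measurable_armaProcess φ ξ _).aemeasurable

/-! ### Symmetric contamination balls -/

/-- A law on `ℝ` that is symmetric about `0`. -/
def IsSymmetricLaw (H : ProbabilityMeasure ℝ) : Prop :=
  (H : Measure ℝ).map (fun v => -v) = H

namespace ErrorModel

variable {ι Y : Type} [MeasurableSpace Y]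

/-- All `(1 - ε) F + ε H` with `H` symmetric and regular for the model. -/
def contamination (M : ErrorModel ι Y) (F : ProbabilityMeasure ℝ) (ε : ℝ) :
    Set (ProbabilityMeasure ℝ) :=
  {G | ∃ H ∈ M.errors, IsSymmetricLaw H ∧
    (G : Measure ℝ) = ENNReal.ofReal (1 - ε) • (F : Measure ℝ) +
      ENNReal.ofReal ε • (H : Measure ℝ)}

/-- The symmetric contamination ball of radius `ε` about `F`: contamination of any amount
`s ≤ ε`. -/
def contaminationBall (M : ErrorModel ι Y) (F : ProbabilityMeasure ℝ) (ε : ℝ) :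
    Set (ProbabilityMeasure ℝ) :=
  ⋃ s ∈ Icc (0 : ℝ) ε, M.contamination F s

variable [Fintype ι] [DecidableEq ι]

/-- The standardized estimator `(n I_{F,θ})^{1/2} (S_n - θ)`, with the positive semidefinite
square root. -/
def standardized (M : ErrorModel ι Y) (F : ProbabilityMeasure ℝ) {n : ℕ}
    (S : (Fin n → Y) → ι → ℝ) (y : Fin n → Y) : ι → ℝ :=
  (CFC.sqrt ((n : ℝ) • M.info F)).mulVec (S y - M.param)

/-- The law `ℒ_{F,θ} {(n I_{F,θ})^{1/2} (S_n - θ)}`. -/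
def stdLaw (M : ErrorModel ι Y) (F : ProbabilityMeasure ℝ) {n : ℕ}
    (S : (Fin n → Y) → ι → ℝ) : Measure (ι → ℝ) :=
  (M.law F n : Measure (Fin n → Y)).map (M.standardized F S)

/-- `ℒ_{F,θ} {(n I_{F,θ})^{1/2} (S_n - θ)} → N(0, I_k)` weakly. -/
def AsymptoticallyNormal (M : ErrorModel ι Y) (F : ProbabilityMeasure ℝ)
    (S : (n : ℕ) → (Fin n → Y) → ι → ℝ) : Prop :=
  TendstoInDistribution (fun n => M.standardized F (S n)) atTop id
    (fun n => (M.law F n : Measure (Fin n → Y))) (stdNormal ι)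

/-- For all radii `ε_n → 0`, the lower limit of the maximal Kolmogorov distance over the sets
`B F ε_n` is at least `1 - 2^{-k}`. -/
def NonuniformOver (M : ErrorModel ι Y) (F : ProbabilityMeasure ℝ)
    (S : (n : ℕ) → (Fin n → Y) → ι → ℝ)
    (B : ProbabilityMeasure ℝ → ℝ → Set (ProbabilityMeasure ℝ)) : Prop :=
  ∀ ε : ℕ → ℝ, (∀ n, ε n ∈ Ioc (0 : ℝ) 1) → Tendsto ε atTop (𝓝 0) →
    ENNReal.ofReal (1 - 1 / 2 ^ Fintype.card ι) ≤
      liminf (fun n => ⨆ G ∈ B F (ε n), kolmogorovDist (M.stdLaw G (S n)) (stdNormal ι)) atTop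

/-- The lower bound over contamination balls; for symmetric `F` the amount of contamination may
be taken to be exactly `ε_n`. -/
def Nonuniform (M : ErrorModel ι Y) (F : ProbabilityMeasure ℝ)
    (S : (n : ℕ) → (Fin n → Y) → ι → ℝ) : Prop :=
  M.NonuniformOver F S M.contaminationBall ∧
    (IsSymmetricLaw F → M.NonuniformOver F S M.contamination)

end ErrorModel

end

/-! Fisher information is unstable in one direction: an arbitrarily small amount `δ` of a very
concentrated smooth law, mixed into `F`, makes it as large as desired, yet keeps it finite. The law
of `n` observations, by contrast, hardly notices the contamination: for `n` independent observations
it dominates `(1 - δ)^n` times the old law, so that the probability of any event rises by at most `1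
- (1 - δ)^n`. For each fixed `n`, `δ` can be taken so small that this is negligible.

All information matrices of a model are multiples `lam G • A` of one matrix. Hence standardizing
under `G` instead of `F` multiplies the statistic by `c = √(lam G / lam F)`, and `c` can be made
huge. If `0 < u` and `t ≤ c u`, the event that all coordinates standardized under `G` are at most
`t` lies in the event that those standardized under `F` are at most `u`. For small `u` and large `n`
the latter has probability at most about `2^{-k}`, by asymptotic normality under `F`, while the
normal distribution function at a large `t` is nearly `1`. The gap `1 - 2^{-k}` is the assertion.
This argument is `nonuniformOver_of_exists`.

Two inputs depend on the model. The explosion of information is `IsMixture.fisherInfoLoc_ge` and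
`IsMixture.fisherInfoScale_ge`, by rescaled test functions. The stability of the law is
`Measure.pow_smul_pi_le` when finitely many errors enter. For an autoregressive part infinitely many
innovations enter; there the process is truncated, at an error small in mean uniformly over the
contaminations, and closed events are slightly enlarged (`ArmaRegular.exists_law_le`). Continuity of
the estimators is what makes the events closed. -/

/-- `G = (1 - δ) F + δ H`. -/
def IsMixture (F H : ProbabilityMeasure ℝ) (δ : ℝ) (G : ProbabilityMeasure ℝ) : Prop :=
  (G : Measure ℝ) = ENNReal.ofReal (1 - δ) • (F : Measure ℝ) + ENNReal.ofReal δ • (H : Measure ℝ)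

lemma exists_isMixture (F H : ProbabilityMeasure ℝ) {δ : ℝ} (hδ : δ ∈ Icc (0 : ℝ) 1) :
    ∃ G, IsMixture F H δ G := by
  refine ⟨⟨_, ⟨?_⟩⟩, rfl⟩
  simp only [Measure.coe_add, Measure.coe_smul, Pi.add_apply, Pi.smul_apply, measure_univ,
    smul_eq_mul, mul_one]
  rw [← ENNReal.ofReal_add (by linarith [hδ.2]) hδ.1]
  simp

/-- For symmetric `F` the contamination must have exact weight `ε`, although a smaller weight is
wanted: the surplus is spent on `F` itself, as `(1 - ε) + ε (1 - s) = 1 - ε s`. -/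
lemma IsMixture.assoc {F H H' G : ProbabilityMeasure ℝ} {ε s : ℝ} (hε : 0 ≤ ε) (hε1 : ε ≤ 1)
    (hs1 : s ≤ 1) (hH : IsMixture F H s H') (hG : IsMixture F H' ε G) :
    IsMixture F H (ε * s) G := by
  unfold IsMixture at *
  rw [hG, hH, smul_add, smul_smul, smul_smul, ← add_assoc, ← add_smul,
    ← ENNReal.ofReal_mul hε, ← ENNReal.ofReal_mul hε,
    ← ENNReal.ofReal_add (by linarith) (mul_nonneg hε (by linarith))]
  congr 3
  ring

lemma IsSymmetricLaw.mixture {F H G : ProbabilityMeasure ℝ} {δ : ℝ} (hF : IsSymmetricLaw F)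
    (hH : IsSymmetricLaw H) (hG : IsMixture F H δ G) : IsSymmetricLaw G := by
  unfold IsSymmetricLaw IsMixture at *
  rw [hG, Measure.map_add _ _ measurable_neg, Measure.map_smul, Measure.map_smul, hF, hH]

/-- No positivity of `A` is needed, since the square root has the default value `0` off the
nonnegative matrices and a positive factor preserves either case. -/
lemma Matrix.sqrt_smul_of_pos {ι : Type*} [Fintype ι] [DecidableEq ι] (A : Matrix ι ι ℝ) {c : ℝ}
    (hc : 0 < c) : CFC.sqrt (c ^ 2 • A) = c • CFC.sqrt A := by
  by_cases hA : 0 ≤ A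
  · refine CFC.sqrt_unique ?_ (smul_nonneg hc.le (CFC.sqrt_nonneg A))
    rw [smul_mul_smul_comm, CFC.sqrt_mul_sqrt_self A hA, sq]
  · rw [CFC.sqrt_of_not_nonneg hA, CFC.sqrt_of_not_nonneg, smul_zero]
    intro h
    refine hA ?_
    have := smul_nonneg (inv_nonneg.2 (sq_nonneg c)) h
    rwa [smul_smul, inv_mul_cancel₀ (by positivity), one_smul] at this

/-! ### Orthant probabilities of the standard normal law -/

lemma stdNormal_Iic (ι : Type) [Fintype ι] (x : ι → ℝ) :
    stdNormal ι (Iic x) = ∏ i, gaussianReal 0 1 (Iic (x i)) := by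
  rw [stdNormal, ← pi_univ_Iic, Measure.pi_pi]

lemma gaussianReal_Iic_zero : gaussianReal 0 1 (Iic (0 : ℝ)) = 1 / 2 := by
  have h1 : gaussianReal 0 1 (Ici (0 : ℝ)) = gaussianReal 0 1 (Iic (0 : ℝ)) := by
    conv_rhs => rw [← neg_zero, ← gaussianReal_map_neg, neg_zero]
    rw [Measure.map_apply measurable_neg measurableSet_Iic]
    congr 1
    ext x; simp
  have h3 : gaussianReal 0 1 (Ioi (0 : ℝ)) = gaussianReal 0 1 (Ici (0 : ℝ)) := by
    have := nullSingletonClass_gaussianReal (μ := 0) (v := 1) one_ne_zero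
    exact measure_congr Ioi_ae_eq_Ici
  have h2 : gaussianReal 0 1 (Iic (0 : ℝ)) + gaussianReal 0 1 (Iic (0 : ℝ)) = 1 := by
    nth_rw 2 [← h1]
    rw [← h3, ← compl_Iic, measure_add_measure_compl measurableSet_Iic, measure_univ]
  rw [ENNReal.eq_div_iff (by simp) (by simp), two_mul, h2]

lemma stdNormal_Iic_zero (ι : Type) [Fintype ι] :
    (stdNormal ι).real (Iic 0) = 1 / 2 ^ Fintype.card ι := by
  simp [Measure.real, stdNormal_Iic, gaussianReal_Iic_zero]

/-- Continuity from above at the orthant `Iic 0`. A strictly positive `u` is needed because only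
then can a large factor `c` achieve `t ≤ c * u`. -/
lemma exists_pos_stdNormal_Iic_lt (ι : Type) [Fintype ι] {η : ℝ} (hη : 0 < η) :
    ∃ u : ℝ, 0 < u ∧ (stdNormal ι).real (Iic fun _ => u) < 1 / 2 ^ Fintype.card ι + η := by
  have hs : (⋂ n : ℕ, Iic fun _ : ι => 1 / ((n : ℝ) + 1)) = Iic 0 := by
    ext x
    simp only [mem_iInter, mem_Iic, Pi.le_def, Pi.zero_apply]
    refine ⟨fun h i => ge_of_tendsto' tendsto_one_div_add_atTop_nhds_zero_nat fun n => h n i,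
      fun h n i => (h i).trans (by positivity)⟩
  have ht : Tendsto (fun n : ℕ => stdNormal ι (Iic fun _ : ι => 1 / ((n : ℝ) + 1))) atTop
      (𝓝 (stdNormal ι (Iic 0))) := by
    rw [← hs]
    refine tendsto_measure_iInter_atTop (fun n => measurableSet_Iic.nullMeasurableSet) ?_
      ⟨0, measure_ne_top _ _⟩
    exact fun m n hmn => Iic_subset_Iic.2 fun _ => Nat.one_div_le_one_div hmn
  have ht' := (ENNReal.tendsto_toReal (measure_ne_top _ _)).comp ht
  have := ht'.eventually_lt_const (u := 1 / 2 ^ Fintype.card ι + η) (by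
    rw [← stdNormal_Iic_zero]; exact lt_add_of_pos_right _ hη)
  obtain ⟨n, hn⟩ := this.exists
  exact ⟨1 / ((n : ℝ) + 1), by positivity, hn⟩

lemma exists_stdNormal_Iic_gt (ι : Type) [Fintype ι] {η : ℝ} (hη : 0 < η) :
    ∃ t : ℝ, 0 < t ∧ 1 - η < (stdNormal ι).real (Iic fun _ => t) := by
  have hs : (⋃ n : ℕ, Iic fun _ : ι => ((n : ℝ))) = univ := by
    refine eq_univ_of_forall fun x => mem_iUnion.2 ?_
    obtain ⟨n, hn⟩ := exists_nat_ge (∑ i, |x i|)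
    exact ⟨n, fun i => ((le_abs_self _).trans
      (Finset.single_le_sum (fun j _ => abs_nonneg (x j)) (Finset.mem_univ i))).trans hn⟩
  have ht : Tendsto (fun n : ℕ => stdNormal ι (Iic fun _ : ι => (n : ℝ))) atTop
      (𝓝 1) := by
    rw [← measure_univ (μ := stdNormal ι), ← hs]
    refine tendsto_measure_iUnion_atTop ?_
    exact fun m n hmn => Iic_subset_Iic.2 fun _ => Nat.cast_le.2 hmn
  have ht' := (ENNReal.tendsto_toReal ENNReal.one_ne_top).comp ht
  have := ht'.eventually_const_lt (show 1 - η < ENNReal.toReal 1 by simpa using hη)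
  obtain ⟨n, hn, hn0⟩ := (this.and (eventually_gt_atTop 0)).exists
  exact ⟨n, by exact_mod_cast hn0, hn⟩

/-! ### Reduction to contaminations with large information -/

namespace ErrorModel

variable {ι Y : Type} [MeasurableSpace Y] [Fintype ι] [DecidableEq ι]

lemma measurable_standardized (M : ErrorModel ι Y) (F : ProbabilityMeasure ℝ) {n : ℕ}
    {S : (Fin n → Y) → ι → ℝ} (hS : Measurable S) : Measurable (M.standardized F S) := by
  unfold standardized
  exact (Continuous.matrix_mulVec continuous_const continuous_id).measurable.comp
    (hS.sub_const _)

lemma continuous_standardized [TopologicalSpace Y] (M : ErrorModel ι Y)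
    (F : ProbabilityMeasure ℝ) {n : ℕ} {S : (Fin n → Y) → ι → ℝ} (hS : Continuous S) :
    Continuous (M.standardized F S) := by
  unfold standardized
  exact Continuous.matrix_mulVec continuous_const (hS.sub continuous_const)

/-- If both information matrices are multiples of the same matrix, then the standardized estimators
are multiples of each other. -/
lemma standardized_eq_smul {M : ErrorModel ι Y} {A : Matrix ι ι ℝ}
    {lam : ProbabilityMeasure ℝ → ℝ} (hinfo : ∀ G, M.info G = lam G • A)
    {F G : ProbabilityMeasure ℝ} {c : ℝ} (hc : 0 < c) (h : lam G = c ^ 2 * lam F) {n : ℕ}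
    (S : (Fin n → Y) → ι → ℝ) (y : Fin n → Y) :
    M.standardized G S y = c • M.standardized F S y := by
  unfold standardized
  rw [hinfo, hinfo, h, mul_smul, smul_comm, Matrix.sqrt_smul_of_pos _ hc, Matrix.smul_mulVec]

/-- The closed-set half of the portmanteau theorem; only upper bounds on orthant probabilities enter
the argument. -/
lemma AsymptoticallyNormal.eventually_lt {M : ErrorModel ι Y} {F : ProbabilityMeasure ℝ}
    {S : (n : ℕ) → (Fin n → Y) → ι → ℝ} (h : M.AsymptoticallyNormal F S) (x : ι → ℝ) {b : ℝ}
    (hb : (stdNormal ι).real (Iic x) < b) :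
    ∀ᶠ n in atTop, (M.law F n : Measure (Fin n → Y)).real (M.standardized F (S n) ⁻¹' Iic x)
      < b := by
  have hb0 : 0 < b := measureReal_nonneg.trans_lt hb
  have h1 := ProbabilityMeasure.limsup_measure_closed_le_of_tendsto h.tendsto
    (isClosed_Iic (a := x))
  have h2 : limsup (fun n => (M.law F n : Measure (Fin n → Y)).map (M.standardized F (S n))
      (Iic x)) atTop < ENNReal.ofReal b := by
    refine lt_of_le_of_lt h1 ?_
    simp only [ProbabilityMeasure.coe_mk, Measure.map_id]
    rwa [ENNReal.lt_ofReal_iff_toReal_lt (measure_ne_top _ _)]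
  filter_upwards [eventually_lt_of_limsup_lt h2] with n hn
  rw [Measure.map_apply_of_aemeasurable (h.forall_aemeasurable n) measurableSet_Iic] at hn
  exact (ENNReal.lt_ofReal_iff_toReal_lt (measure_ne_top _ _)).1 hn

/-- Arbitrarily small contaminations of `F` that change the law of `n` observations by little can
increase the information factor `lam` beyond all bounds. -/
def Contaminable (M : ErrorModel ι Y) (lam : ProbabilityMeasure ℝ → ℝ) (F : ProbabilityMeasure ℝ)
    (n : ℕ) (D : Set (Fin n → Y)) : Prop :=
  ∀ B η : ℝ, 0 < η → ∃ δ₀ > (0 : ℝ), ∀ δ ∈ Ioc (0 : ℝ) 1, δ ≤ δ₀ →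
    ∃ H ∈ M.errors, IsSymmetricLaw H ∧ ∀ G, IsMixture F H δ G → B ≤ lam G ∧
      (M.law G n : Measure (Fin n → Y)).real D ≤ (M.law F n : Measure (Fin n → Y)).real D + η

/-- The scaling argument: inflating the information pulls the orthant at `t` for the statistic
standardized under `G` inside the orthant at `u` for the one standardized under `F`. The losses are
one `η` each for `u`, for `t` and for the change of law; `4 * η` leaves slack. -/
theorem nonuniformOver_of_exists {M : ErrorModel ι Y} {F : ProbabilityMeasure ℝ}
    {S : (n : ℕ) → (Fin n → Y) → ι → ℝ} (hS : ∀ n, Measurable (S n)) {A : Matrix ι ι ℝ}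
    {lam : ProbabilityMeasure ℝ → ℝ} (hinfo : ∀ G, M.info G = lam G • A) (hlam : 0 ≤ lam F)
    (hN : M.AsymptoticallyNormal F S) {B : ProbabilityMeasure ℝ → ℝ → Set (ProbabilityMeasure ℝ)}
    (hB : ∀ ε ∈ Ioc (0 : ℝ) 1, ∀ n u, ∀ b η : ℝ, 0 < η → ∃ G ∈ B F ε, b ≤ lam G ∧
      (M.law G n : Measure (Fin n → Y)).real (M.standardized F (S n) ⁻¹' Iic u) ≤
        (M.law F n : Measure (Fin n → Y)).real (M.standardized F (S n) ⁻¹' Iic u) + η) :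
    M.NonuniformOver F S B := by
  intro ε hε _
  rcases Nat.eq_zero_or_pos (Fintype.card ι) with hk | hk
  · simp [hk]
  have key : ∀ η : ℝ, 0 < η → ENNReal.ofReal (1 - 1 / 2 ^ Fintype.card ι - 4 * η) ≤
      liminf (fun n => ⨆ G ∈ B F (ε n), kolmogorovDist (M.stdLaw G (S n)) (stdNormal ι)) atTop := by
    intro η hη
    obtain ⟨u, hu, hu'⟩ := exists_pos_stdNormal_Iic_lt ι hη
    obtain ⟨t, ht, ht'⟩ := exists_stdNormal_Iic_gt ι hη
    have ev := hN.eventually_lt _ hu'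
    -- If the information factor vanishes, the standardized statistic is `0` and lies in the orthant
    -- surely. Then `1 < 2^{-k} + η`, and the bound to be shown is trivial.
    have hF : 0 < lam F ∨ 1 - 1 / 2 ^ Fintype.card ι - 4 * η ≤ 0 := by
      rcases hlam.lt_or_eq with h | h
      · exact Or.inl h
      · right
        obtain ⟨n, hn⟩ := ev.exists
        have : M.standardized F (S n) ⁻¹' (Iic fun _ => u) = univ := by
          refine eq_univ_of_forall fun y => ?_
          simp only [standardized, hinfo, ← h, zero_smul, smul_zero, CFC.sqrt_zero,
            Matrix.zero_mulVec, mem_preimage, mem_Iic]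
          exact fun _ => hu.le
        rw [this, probReal_univ] at hn
        linarith
    rcases hF with hF | hF
    swap
    · rw [ENNReal.ofReal_of_nonpos hF]; exact zero_le
    refine le_liminf_of_le (by isBoundedDefault) ?_
    filter_upwards [ev] with n hn
    -- The threshold `(t / u) ^ 2 * lam F` is what gives `c ≥ t / u`, hence `t ≤ c * u`.
    obtain ⟨G, hG, hlG, hlaw⟩ := hB (ε n) (hε n) n (fun _ => u) ((t / u) ^ 2 * lam F) η hη
    refine le_trans ?_ (le_iSup₂ (f := fun G (_ : G ∈ B F (ε n)) =>
      kolmogorovDist (M.stdLaw G (S n)) (stdNormal ι)) G hG)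
    refine le_trans ?_ (le_iSup (fun x : ι → ℝ =>
      ENNReal.ofReal |(M.stdLaw G (S n)).real (Iic x) - (stdNormal ι).real (Iic x)|) fun _ => t)
    refine ENNReal.ofReal_le_ofReal ?_
    have hlG0 : 0 < lam G := lt_of_lt_of_le (by positivity) hlG
    set c := Real.sqrt (lam G / lam F) with hcdef
    have hc : 0 < c := Real.sqrt_pos.2 (by positivity)
    have hc2 : lam G = c ^ 2 * lam F := by
      rw [hcdef, Real.sq_sqrt (by positivity), div_mul_cancel₀ _ hF.ne']
    have htc : t ≤ c * u := by
      have : t / u ≤ c := Real.le_sqrt_of_sq_le ((le_div_iff₀ hF).2 hlG)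
      rwa [div_le_iff₀ hu] at this
    have hsub : M.standardized G (S n) ⁻¹' (Iic fun _ => t) ⊆
        M.standardized F (S n) ⁻¹' (Iic fun _ => u) := by
      intro y hy i
      have := hy i
      rw [standardized_eq_smul hinfo hc hc2, Pi.smul_apply, smul_eq_mul] at this
      exact le_of_mul_le_mul_left (this.trans htc) hc
    have h1 : (M.stdLaw G (S n)).real (Iic fun _ => t) ≤
        (M.law G n : Measure (Fin n → Y)).real (M.standardized F (S n) ⁻¹' Iic fun _ => u) := by
      rw [stdLaw, map_measureReal_apply (M.measurable_standardized G (hS n)) measurableSet_Iic]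
      exact measureReal_mono hsub
    rw [abs_sub_comm]
    refine le_trans ?_ (le_abs_self _)
    linarith
  have hlim : Tendsto (fun η : ℝ => ENNReal.ofReal (1 - 1 / 2 ^ Fintype.card ι - 4 * η)) (𝓝[>] 0)
      (𝓝 (ENNReal.ofReal (1 - 1 / 2 ^ Fintype.card ι))) := by
    refine Tendsto.mono_left ?_ nhdsWithin_le_nhds
    refine Continuous.tendsto' (ENNReal.continuous_ofReal.comp (by fun_prop)) _ _ (by simp)
  exact le_of_tendsto hlim (eventually_mem_nhdsWithin.mono fun η hη => key η hη)

theorem nonuniform_of_contaminable {M : ErrorModel ι Y} {F : ProbabilityMeasure ℝ}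
    {S : (n : ℕ) → (Fin n → Y) → ι → ℝ} (hS : ∀ n, Measurable (S n))
    {A : Matrix ι ι ℝ} {lam : ProbabilityMeasure ℝ → ℝ} (hinfo : ∀ G, M.info G = lam G • A)
    (hlam : 0 ≤ lam F)
    (hmix : ∀ H ∈ M.errors, ∀ δ ∈ Icc (0 : ℝ) 1, ∀ G, IsMixture F H δ G → G ∈ M.errors)
    (hC : ∀ n u, M.Contaminable lam F n (M.standardized F (S n) ⁻¹' Iic u))
    (hN : M.AsymptoticallyNormal F S) : M.Nonuniform F S := by
  refine ⟨nonuniformOver_of_exists hS hinfo hlam hN fun ε hε n u b η hη => ?_,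
    fun hsym => nonuniformOver_of_exists hS hinfo hlam hN fun ε hε n u b η hη => ?_⟩
  · obtain ⟨δ₀, hδ₀, h⟩ := hC n u b η hη
    have hm : 0 < min ε δ₀ := lt_min hε.1 hδ₀
    have hm1 : min ε δ₀ ≤ 1 := (min_le_left _ _).trans hε.2
    obtain ⟨H, hH, hHs, hG⟩ := h (min ε δ₀) ⟨hm, hm1⟩ (min_le_right _ _)
    obtain ⟨G, hmG⟩ := exists_isMixture F H ⟨hm.le, hm1⟩
    exact ⟨G, mem_biUnion (x := min ε δ₀) ⟨hm.le, min_le_left _ _⟩ ⟨H, hH, hHs, hmG⟩, hG G hmG⟩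
  · obtain ⟨δ₀, hδ₀, h⟩ := hC n u b η hη
    have hm : 0 < min ε δ₀ := lt_min hε.1 hδ₀
    have hm1 : min ε δ₀ ≤ 1 := (min_le_left _ _).trans hε.2
    obtain ⟨H, hH, hHs, hG⟩ := h (min ε δ₀) ⟨hm, hm1⟩ (min_le_right _ _)
    -- The relative amount `s = min ε δ₀ / ε` makes the effective contamination `ε * s = min ε δ₀`,
    -- while the nominal weight stays `ε`.
    have hs0 : 0 ≤ min ε δ₀ / ε := div_nonneg hm.le hε.1.le
    have hs1 : min ε δ₀ / ε ≤ 1 := (div_le_one hε.1).2 (min_le_left _ _)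
    obtain ⟨H', hH'⟩ := exists_isMixture F H ⟨hs0, hs1⟩
    obtain ⟨G, hmG⟩ := exists_isMixture F H' ⟨hε.1.le, hε.2⟩
    refine ⟨G, ⟨H', hmix H hH _ ⟨hs0, hs1⟩ H' hH', hsym.mixture hHs hH', hmG⟩, hG G ?_⟩
    have := hH'.assoc hε.1.le hε.2 hs1 hmG
    rwa [mul_div_cancel₀ _ hε.1.ne'] at this

end ErrorModel

/-! ### Mixtures -/

lemma IsMixture.integral_eq {F H G : ProbabilityMeasure ℝ} {δ : ℝ} (hδ : δ ∈ Icc (0 : ℝ) 1)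
    (hG : IsMixture F H δ G) {f : ℝ → ℝ} (hF : Integrable f (F : Measure ℝ))
    (hH : Integrable f (H : Measure ℝ)) :
    ∫ v, f v ∂(G : Measure ℝ) =
      (1 - δ) * ∫ v, f v ∂(F : Measure ℝ) + δ * ∫ v, f v ∂(H : Measure ℝ) := by
  rw [hG, integral_add_measure (hF.smul_measure (by simp)) (hH.smul_measure (by simp)),
    integral_smul_measure, integral_smul_measure, ENNReal.toReal_ofReal (by linarith [hδ.2]),
    ENNReal.toReal_ofReal hδ.1, smul_eq_mul, smul_eq_mul]

lemma IsMixture.integrable {F H G : ProbabilityMeasure ℝ} {δ : ℝ}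
    (hG : IsMixture F H δ G) {f : ℝ → ℝ} (hF : Integrable f (F : Measure ℝ))
    (hH : Integrable f (H : Measure ℝ)) : Integrable f (G : Measure ℝ) := by
  rw [hG]
  exact (hF.smul_measure (by simp)).add_measure (hH.smul_measure (by simp))

/-- Convexity of the square: the defect is `δ (1 - δ) (x₁ - x₂)²`. Thus a bound on the Fisher
information of both components is inherited by their mixture. -/
lemma sq_mixture_le {δ C x₁ x₂ y₁ y₂ : ℝ} (hδ : δ ∈ Icc (0 : ℝ) 1) (h₁ : x₁ ^ 2 ≤ C * y₁)
    (h₂ : x₂ ^ 2 ≤ C * y₂) :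
    ((1 - δ) * x₁ + δ * x₂) ^ 2 ≤ C * ((1 - δ) * y₁ + δ * y₂) := by
  have h3 : 0 ≤ δ * (1 - δ) * (x₁ - x₂) ^ 2 :=
    mul_nonneg (mul_nonneg hδ.1 (by linarith [hδ.2])) (sq_nonneg _)
  have h4 := mul_le_mul_of_nonneg_left h₁ (show 0 ≤ 1 - δ by linarith [hδ.2])
  have h5 := mul_le_mul_of_nonneg_left h₂ hδ.1
  nlinarith

lemma Continuous.integrable_of_bounded {μ : Measure ℝ} [IsFiniteMeasure μ] {f : ℝ → ℝ}
    (hf : Continuous f) {C : ℝ} (hC : ∀ x, |f x| ≤ C) : Integrable f μ :=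
  Integrable.of_bound hf.aestronglyMeasurable C (ae_of_all _ hC)

lemma Continuous.integrable_sq_of_bounded {μ : Measure ℝ} [IsFiniteMeasure μ] {f : ℝ → ℝ}
    (hf : Continuous f) {C : ℝ} (hC : ∀ x, |f x| ≤ C) : Integrable (fun x => f x ^ 2) μ :=
  Integrable.of_bound (by fun_prop) (C ^ 2) (ae_of_all _ fun x => by
    rw [norm_pow]; exact pow_le_pow_left₀ (abs_nonneg _) (hC x) 2)

/-- A differentiable function on the line whose derivative is continuous of compact support is
bounded. -/
lemma exists_abs_le_of_hasCompactSupport_deriv {φ : ℝ → ℝ} (hφ : ContDiff ℝ 1 φ)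
    (hs : HasCompactSupport (deriv φ)) : ∃ C, ∀ x, |φ x| ≤ C := by
  have hc : Continuous (deriv φ) := hφ.continuous_deriv le_rfl
  have hd : Differentiable ℝ φ := hφ.differentiable one_ne_zero
  refine ⟨|φ 0| + ∫ x, |deriv φ x|, fun x => ?_⟩
  have hi : Integrable (deriv φ) := hc.integrable_of_hasCompactSupport hs
  have h1 : ∫ t in (0 : ℝ)..x, deriv φ t = φ x - φ 0 :=
    intervalIntegral.integral_deriv_eq_sub (fun t _ => hd t) (hc.intervalIntegrable _ _)
  have h2 : |∫ t in (0 : ℝ)..x, deriv φ t| ≤ ∫ t, |deriv φ t| := by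
    refine (intervalIntegral.norm_integral_le_integral_norm_uIoc (f := deriv φ)).trans ?_
    exact setIntegral_le_integral hi.norm (ae_of_all _ fun _ => norm_nonneg _)
  rw [h1] at h2
  have := abs_add_le (φ x - φ 0) (φ 0)
  rw [sub_add_cancel] at this
  linarith

lemma exists_abs_le_of_hasCompactSupport {φ : ℝ → ℝ} (hφ : Continuous φ)
    (hs : HasCompactSupport φ) : ∃ C, ∀ x, |φ x| ≤ C :=
  hs.exists_bound_of_continuous hφ

/-! ### Bounds for the Fisher information -/

lemma ENNReal.ofReal_div_ofReal_le_iff {a b C : ℝ} (hC : 0 ≤ C) (hb : 0 ≤ b) :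
    ENNReal.ofReal a / ENNReal.ofReal b ≤ ENNReal.ofReal C ↔ a ≤ C * b := by
  rw [ENNReal.div_le_iff_le_mul (Or.inr ENNReal.ofReal_ne_top) (Or.inl ENNReal.ofReal_ne_top),
    ← ENNReal.ofReal_mul hC, ENNReal.ofReal_le_ofReal_iff (mul_nonneg hC hb)]

/-- The quotient-free form is linear in `F` on each side under the square, which suits mixtures; the
conventions for `0 / 0` and `c / 0` are exactly those that make it an equivalence. -/
lemma fisherInfoLoc_le_iff {F : ProbabilityMeasure ℝ} {C : ℝ} (hC : 0 ≤ C) :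
    fisherInfoLoc F ≤ ENNReal.ofReal C ↔ ∀ φ : ℝ → ℝ, ContDiff ℝ 1 φ → HasCompactSupport φ →
      (∫ v, deriv φ v ∂(F : Measure ℝ)) ^ 2 ≤ C * ∫ v, φ v ^ 2 ∂(F : Measure ℝ) := by
  simp only [fisherInfoLoc, iSup_le_iff,
    ENNReal.ofReal_div_ofReal_le_iff hC (integral_nonneg fun _ => sq_nonneg _)]

lemma fisherInfoScale_le_iff {F : ProbabilityMeasure ℝ} {C : ℝ} (hC : 0 ≤ C) :
    fisherInfoScale F ≤ ENNReal.ofReal C ↔ ∀ φ : ℝ → ℝ, ContDiff ℝ 1 φ →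
      HasCompactSupport (deriv φ) →
      (∫ v, v * deriv φ v ∂(F : Measure ℝ)) ^ 2 ≤ C * ∫ v, φ v ^ 2 ∂(F : Measure ℝ) := by
  simp only [fisherInfoScale, iSup_le_iff,
    ENNReal.ofReal_div_ofReal_le_iff hC (integral_nonneg fun _ => sq_nonneg _)]

lemma fisherInfoLoc_mixture_lt_top {F H G : ProbabilityMeasure ℝ} {δ : ℝ}
    (hδ : δ ∈ Icc (0 : ℝ) 1) (hG : IsMixture F H δ G) (hF : fisherInfoLoc F < ∞)
    (hH : fisherInfoLoc H < ∞) : fisherInfoLoc G < ∞ := by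
  have hM : max (fisherInfoLoc F) (fisherInfoLoc H) ≠ ∞ := (max_lt hF hH).ne
  set C := (max (fisherInfoLoc F) (fisherInfoLoc H)).toReal
  have hC : 0 ≤ C := ENNReal.toReal_nonneg
  have h₁ := (fisherInfoLoc_le_iff hC).1 ((le_max_left _ _).trans (ENNReal.ofReal_toReal hM).ge)
  have h₂ := (fisherInfoLoc_le_iff hC).1 ((le_max_right _ _).trans (ENNReal.ofReal_toReal hM).ge)
  refine lt_of_le_of_lt ((fisherInfoLoc_le_iff hC).2 fun φ hφ hs => ?_) ENNReal.ofReal_lt_top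
  obtain ⟨B, hB⟩ := exists_abs_le_of_hasCompactSupport (hφ.continuous_deriv le_rfl) hs.deriv
  obtain ⟨B', hB'⟩ := exists_abs_le_of_hasCompactSupport hφ.continuous hs
  rw [hG.integral_eq hδ ((hφ.continuous_deriv le_rfl).integrable_of_bounded hB)
    ((hφ.continuous_deriv le_rfl).integrable_of_bounded hB),
    hG.integral_eq hδ (hφ.continuous.integrable_sq_of_bounded hB')
    (hφ.continuous.integrable_sq_of_bounded hB')]
  exact sq_mixture_le hδ (h₁ φ hφ hs) (h₂ φ hφ hs)

lemma fisherInfoScale_mixture_lt_top {F H G : ProbabilityMeasure ℝ} {δ : ℝ}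
    (hδ : δ ∈ Icc (0 : ℝ) 1) (hG : IsMixture F H δ G) (hF : fisherInfoScale F < ∞)
    (hH : fisherInfoScale H < ∞) : fisherInfoScale G < ∞ := by
  have hM : max (fisherInfoScale F) (fisherInfoScale H) ≠ ∞ := (max_lt hF hH).ne
  set C := (max (fisherInfoScale F) (fisherInfoScale H)).toReal
  have hC : 0 ≤ C := ENNReal.toReal_nonneg
  have h₁ := (fisherInfoScale_le_iff hC).1 ((le_max_left _ _).trans (ENNReal.ofReal_toReal hM).ge)
  have h₂ := (fisherInfoScale_le_iff hC).1 ((le_max_right _ _).trans (ENNReal.ofReal_toReal hM).ge)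
  refine lt_of_le_of_lt ((fisherInfoScale_le_iff hC).2 fun φ hφ hs => ?_) ENNReal.ofReal_lt_top
  have hc : Continuous fun v => v * deriv φ v := continuous_id.mul (hφ.continuous_deriv le_rfl)
  obtain ⟨B, hB⟩ := exists_abs_le_of_hasCompactSupport hc hs.mul_left
  obtain ⟨B', hB'⟩ := exists_abs_le_of_hasCompactSupport_deriv hφ hs
  rw [hG.integral_eq hδ (hc.integrable_of_bounded hB) (hc.integrable_of_bounded hB),
    hG.integral_eq hδ (hφ.continuous.integrable_sq_of_bounded hB')
    (hφ.continuous.integrable_sq_of_bounded hB')]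
  exact sq_mixture_le hδ (h₁ φ hφ hs) (h₂ φ hφ hs)

/-! ### Gaussian laws -/

lemma integrable_pow_gaussianReal (n : ℕ) :
    Integrable (fun x : ℝ => x ^ n) (gaussianReal 0 1) := by
  have h := (memLp_id_gaussianReal (μ := 0) (v := 1) n).integrable_norm_pow'
  exact h.mono' (by fun_prop) (ae_of_all _ fun x => by simp)

/-- Stein's identity. -/
lemma integral_deriv_gaussianReal {u : ℝ → ℝ} (hu : Differentiable ℝ u)
    (h₀ : Integrable u (gaussianReal 0 1)) (h₁ : Integrable (deriv u) (gaussianReal 0 1))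
    (h₂ : Integrable (fun x => x * u x) (gaussianReal 0 1)) :
    ∫ x, deriv u x ∂gaussianReal 0 1 = ∫ x, x * u x ∂gaussianReal 0 1 := by
  set p := gaussianPDFReal 0 1 with hp
  have key : ∀ f : ℝ → ℝ, Integrable f (gaussianReal 0 1) → Integrable fun x => p x * f x := by
    intro f hf
    rw [gaussianReal_of_var_ne_zero 0 one_ne_zero, integrable_withDensity_iff_integrable_smul'
      (measurable_gaussianPDF 0 1) (ae_of_all _ fun _ => gaussianPDF_lt_top)] at hf
    simpa only [toReal_gaussianPDF, smul_eq_mul] using hf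
  have hpd : ∀ x, HasDerivAt p (-x * p x) x := by
    intro x
    have h1 : HasDerivAt (fun x : ℝ => -(x - 0) ^ 2 / (2 * ((1 : NNReal) : ℝ))) (-x) x := by
      have := ((((hasDerivAt_id x).sub_const 0).pow 2).neg).div_const (2 * ((1 : NNReal) : ℝ))
      refine this.congr_deriv ?_
      simp only [id, NNReal.coe_one, sub_zero, Nat.cast_ofNat]
      ring
    have := h1.exp.const_mul (Real.sqrt (2 * Real.pi * ((1 : NNReal) : ℝ)))⁻¹
    rw [hp, gaussianPDFReal_def]
    refine this.congr_deriv ?_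
    ring
  -- Integration by parts against the density, with `p' = -x p`; integrability of the products
  -- leaves no boundary terms.
  have := integral_mul_deriv_eq_deriv_mul_of_integrable (u := u) (u' := deriv u)
    (v := p) (v' := fun x => -x * p x) (fun x _ => (hu x).hasDerivAt) (fun x _ => hpd x)
    ((key _ h₂).neg.congr (ae_of_all _ fun x => by simp; ring))
    ((key _ h₁).congr (ae_of_all _ fun x => by simp; ring))
    ((key _ h₀).congr (ae_of_all _ fun x => by simp; ring))
  rw [integral_gaussianReal_eq_integral_smul one_ne_zero,
    integral_gaussianReal_eq_integral_smul one_ne_zero]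
  simp only [smul_eq_mul]
  calc ∫ x, p x * deriv u x = ∫ x, deriv u x * p x := by simp only [mul_comm]
    _ = -∫ x, u x * (-x * p x) := by rw [this, neg_neg]
    _ = ∫ x, p x * (x * u x) := by
      rw [← integral_neg]; exact integral_congr_ae (ae_of_all _ fun x => by ring)

lemma integral_gaussianReal_pos {f : ℝ → ℝ} (hf : Continuous f) (hs : HasCompactSupport f)
    (h0 : 0 ≤ f) {x : ℝ} (hx : f x ≠ 0) : 0 < ∫ x, f x ∂gaussianReal 0 1 := by
  have : (gaussianReal 0 1).IsOpenPosMeasure :=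
    (gaussianReal_absolutelyContinuous' 0 one_ne_zero).isOpenPosMeasure
  exact hf.integral_pos_of_hasCompactSupport_nonneg_nonzero hs h0 hx

/-- The normal law with mean `a` and standard deviation `|τ|`. -/
noncomputable def gaussLaw (a τ : ℝ) : ProbabilityMeasure ℝ :=
  ⟨(gaussianReal 0 1).map fun x : ℝ => a + τ * x,
    Measure.isProbabilityMeasure_map (by fun_prop)⟩

lemma toMeasure_gaussLaw (a τ : ℝ) :
    (gaussLaw a τ : Measure ℝ) = (gaussianReal 0 1).map fun x : ℝ => a + τ * x := rfl

lemma integral_gaussLaw (a τ : ℝ) {f : ℝ → ℝ} (hf : Continuous f) :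
    ∫ v, f v ∂(gaussLaw a τ : Measure ℝ) = ∫ x, f (a + τ * x) ∂gaussianReal 0 1 := by
  rw [toMeasure_gaussLaw, integral_map (by fun_prop) hf.aestronglyMeasurable]

lemma map_neg_gaussLaw (a τ : ℝ) :
    (gaussLaw a τ : Measure ℝ).map (fun v => -v) = gaussLaw (-a) τ := by
  rw [toMeasure_gaussLaw, toMeasure_gaussLaw, Measure.map_map (by fun_prop) (by fun_prop)]
  have h : (gaussianReal 0 1).map (fun x : ℝ => -x) = gaussianReal 0 1 := by
    rw [gaussianReal_map_neg, neg_zero]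
  conv_rhs => rw [← h]
  rw [Measure.map_map (by fun_prop) (by fun_prop)]
  congr 1
  ext x
  simp; ring

lemma isSymmetricLaw_gaussLaw (τ : ℝ) : IsSymmetricLaw (gaussLaw 0 τ) := by
  rw [IsSymmetricLaw, map_neg_gaussLaw, neg_zero]

/-- Cauchy–Schwarz, from the discriminant of the nonnegative quadratic `t ↦ ∫ (t g + f)²`. -/
lemma sq_integral_mul_le {μ : Measure ℝ} {f g : ℝ → ℝ} (hf : Integrable (fun x => f x ^ 2) μ)
    (hg : Integrable (fun x => g x ^ 2) μ) (hfg : Integrable (fun x => f x * g x) μ) :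
    (∫ x, f x * g x ∂μ) ^ 2 ≤ (∫ x, f x ^ 2 ∂μ) * ∫ x, g x ^ 2 ∂μ := by
  have h : ∀ t : ℝ, 0 ≤ (∫ x, g x ^ 2 ∂μ) * (t * t) + (2 * ∫ x, f x * g x ∂μ) * t +
      ∫ x, f x ^ 2 ∂μ := by
    intro t
    have h0 : 0 ≤ ∫ x, (t * g x + f x) ^ 2 ∂μ := integral_nonneg fun _ => sq_nonneg _
    have h1 : ∀ x, (t * g x + f x) ^ 2 = t * t * g x ^ 2 + 2 * t * (f x * g x) + f x ^ 2 :=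
      fun x => by ring
    simp only [h1] at h0
    rw [integral_add (by exact (hg.const_mul _).add (hfg.const_mul _)) hf,
      integral_add (hg.const_mul _) (hfg.const_mul _), integral_const_mul,
      integral_const_mul] at h0
    linarith
  have := discrim_le_zero h
  rw [discrim] at this
  nlinarith

/-- The common part of the bounds for the Fisher informations of normal laws. -/
lemma fisherInfo_bound_aux {q φ : ℝ → ℝ} (hφ : Continuous φ) {C : ℝ} (hC : ∀ x, |φ x| ≤ C)
    (hq : Continuous q) (hq2 : Integrable (fun x => q x ^ 2) (gaussianReal 0 1)) (a τ : ℝ) :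
    (∫ x, q x * φ (a + τ * x) ∂gaussianReal 0 1) ^ 2 ≤
      (∫ x, q x ^ 2 ∂gaussianReal 0 1) * ∫ v, φ v ^ 2 ∂(gaussLaw a τ : Measure ℝ) := by
  rw [integral_gaussLaw a τ (by fun_prop : Continuous fun v => φ v ^ 2)]
  have hφ' : Continuous fun x => φ (a + τ * x) := by fun_prop
  have h2 : Integrable (fun x => φ (a + τ * x) ^ 2) (gaussianReal 0 1) :=
    hφ'.integrable_sq_of_bounded fun x => hC _
  refine sq_integral_mul_le hq2 h2 ?_
  refine (hq2.add h2).mono' (by fun_prop) (ae_of_all _ fun x => ?_)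
  simp only [Pi.add_apply, Real.norm_eq_abs]
  rw [abs_le]
  constructor <;> nlinarith [sq_nonneg (q x + φ (a + τ * x)), sq_nonneg (q x - φ (a + τ * x))]

/-- Stein's identity for `φ (a + τ x) / τ` turns `∫ φ'` into `∫ (x / τ) φ (a + τ x)`, and
Cauchy–Schwarz bounds the information by the second moment of the score `x / τ`. -/
lemma fisherInfoLoc_gaussLaw_lt_top (a : ℝ) {τ : ℝ} (hτ : 0 < τ) :
    fisherInfoLoc (gaussLaw a τ) < ∞ := by
  have hq2 : Integrable (fun x : ℝ => (x / τ) ^ 2) (gaussianReal 0 1) := by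
    simp only [div_pow]; exact (integrable_pow_gaussianReal 2).div_const _
  refine lt_of_le_of_lt ((fisherInfoLoc_le_iff (C := ∫ x, (x / τ) ^ 2 ∂gaussianReal 0 1)
    (integral_nonneg fun _ => sq_nonneg _)).2 fun φ hφ hs => ?_) ENNReal.ofReal_lt_top
  obtain ⟨B, hB⟩ := exists_abs_le_of_hasCompactSupport (hφ.continuous_deriv le_rfl) hs.deriv
  obtain ⟨C, hC⟩ := exists_abs_le_of_hasCompactSupport hφ.continuous hs
  have hcd := hφ.continuous_deriv le_rfl
  have hφc := hφ.continuous
  have hu : ∀ x, HasDerivAt (fun x => φ (a + τ * x) / τ) (deriv φ (a + τ * x)) x := by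
    intro x
    have h1 : HasDerivAt (fun x => a + τ * x) τ x := by
      simpa using ((hasDerivAt_id x).const_mul τ).const_add a
    have h2 := ((hφ.differentiable one_ne_zero (a + τ * x)).hasDerivAt.comp x h1).div_const τ
    exact h2.congr_deriv (by field_simp)
  have hder : deriv (fun x => φ (a + τ * x) / τ) = fun x => deriv φ (a + τ * x) :=
    funext fun x => (hu x).deriv
  have h0 : Integrable (fun x => φ (a + τ * x)) (gaussianReal 0 1) :=
    (by fun_prop : Continuous fun x => φ (a + τ * x)).integrable_of_bounded fun x => hC _
  have hxi : Integrable (fun x => x * (φ (a + τ * x) / τ)) (gaussianReal 0 1) := by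
    refine (((integrable_pow_gaussianReal 1).norm).const_mul (C / τ)).mono' (by fun_prop)
      (ae_of_all _ fun x => ?_)
    rw [norm_mul, norm_div, pow_one, Real.norm_of_nonneg hτ.le, mul_comm]
    gcongr
    exact hC _
  have hst := integral_deriv_gaussianReal (fun x => (hu x).differentiableAt) (h0.div_const τ)
    (by rw [hder]
        exact (by fun_prop : Continuous fun x => deriv φ (a + τ * x)).integrable_of_bounded
          fun x => hB _) hxi
  rw [hder] at hst
  rw [integral_gaussLaw a τ hcd, hst]
  convert fisherInfo_bound_aux hφ.continuous hC (q := fun x => x / τ) (by fun_prop) hq2 a τ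
    using 4
  ring

/-- Stein's identity is applied to `v φ(v) / τ` at `v = a + τ x`, whose derivative in `x` is `φ + v
φ'`. This produces the score `x (a + τ x) / τ - 1`, a polynomial and hence square integrable. -/
lemma fisherInfoScale_gaussLaw_lt_top (a : ℝ) {τ : ℝ} (hτ : 0 < τ) :
    fisherInfoScale (gaussLaw a τ) < ∞ := by
  have hq2 : Integrable (fun x : ℝ => (x * (a + τ * x) / τ - 1) ^ 2) (gaussianReal 0 1) := by
    have h : ∀ x : ℝ, (x * (a + τ * x) / τ - 1) ^ 2 = 1 * x ^ 4 + (2 * a / τ) * x ^ 3 +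
        (a ^ 2 / τ ^ 2 - 2) * x ^ 2 + (-2 * a / τ) * x ^ 1 + 1 * x ^ 0 := fun x => by
      field_simp; ring
    simp only [h]
    exact (((((integrable_pow_gaussianReal 4).const_mul _).add
      ((integrable_pow_gaussianReal 3).const_mul _)).add
      ((integrable_pow_gaussianReal 2).const_mul _)).add
      ((integrable_pow_gaussianReal 1).const_mul _)).add
      ((integrable_pow_gaussianReal 0).const_mul _)
  refine lt_of_le_of_lt ((fisherInfoScale_le_iff
    (C := ∫ x, (x * (a + τ * x) / τ - 1) ^ 2 ∂gaussianReal 0 1)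
    (integral_nonneg fun _ => sq_nonneg _)).2 fun φ hφ hs => ?_) ENNReal.ofReal_lt_top
  obtain ⟨C, hC⟩ := exists_abs_le_of_hasCompactSupport_deriv hφ hs
  have hcd := hφ.continuous_deriv le_rfl
  have hφc := hφ.continuous
  have hwc : Continuous fun v => v * deriv φ v := by fun_prop
  obtain ⟨B, hB⟩ := exists_abs_le_of_hasCompactSupport hwc hs.mul_left
  have hu : ∀ x, HasDerivAt (fun x => (a + τ * x) * φ (a + τ * x) / τ)
      (φ (a + τ * x) + (a + τ * x) * deriv φ (a + τ * x)) x := by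
    intro x
    have h1 : HasDerivAt (fun x => a + τ * x) τ x := by
      simpa using ((hasDerivAt_id x).const_mul τ).const_add a
    have h2 := (h1.mul ((hφ.differentiable one_ne_zero (a + τ * x)).hasDerivAt.comp x h1)).div_const τ
    exact h2.congr_deriv (by simp only [Function.comp]; field_simp)
  have hder : deriv (fun x => (a + τ * x) * φ (a + τ * x) / τ) =
      fun x => φ (a + τ * x) + (a + τ * x) * deriv φ (a + τ * x) :=
    funext fun x => (hu x).deriv
  have h0 : Integrable (fun x => φ (a + τ * x)) (gaussianReal 0 1) :=
    (by fun_prop : Continuous fun x => φ (a + τ * x)).integrable_of_bounded fun x => hC _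
  have h1 : Integrable (fun x => (a + τ * x) * deriv φ (a + τ * x)) (gaussianReal 0 1) :=
    (by fun_prop : Continuous fun x => (a + τ * x) * deriv φ (a + τ * x)).integrable_of_bounded
      fun x => hB _
  have hpol : ∀ k : ℕ, Integrable (fun x => x ^ k * φ (a + τ * x)) (gaussianReal 0 1) := by
    intro k
    refine (((integrable_pow_gaussianReal k).norm).const_mul C).mono' (by fun_prop)
      (ae_of_all _ fun x => ?_)
    rw [norm_mul, mul_comm]
    gcongr
    exact hC _
  have hst := integral_deriv_gaussianReal (fun x => (hu x).differentiableAt)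
    ((((hpol 0).const_mul (a / τ)).add (hpol 1)).congr (ae_of_all _ fun x => by
      simp only [Pi.add_apply]; field_simp))
    (by rw [hder]; exact h0.add h1)
    ((((hpol 1).const_mul (a / τ)).add (hpol 2)).congr (ae_of_all _ fun x => by
      simp only [Pi.add_apply]; field_simp))
  rw [hder, integral_add h0 h1, ← eq_sub_iff_add_eq', ← integral_sub ?_ h0] at hst
  · rw [integral_gaussLaw a τ hwc, hst]
    convert fisherInfo_bound_aux hφ.continuous hC (q := fun x => x * (a + τ * x) / τ - 1)
      (by fun_prop) hq2 a τ using 4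
    ring
  · exact ((((hpol 1).const_mul (a / τ)).add (hpol 2)).congr (ae_of_all _ fun x => by
      simp only [Pi.add_apply]; field_simp))

/-! ### Contaminations with large Fisher information -/

/-- The test function `τ ψ (v / τ)` has derivative of order one on the scale of the peak, so the
numerator stays bounded below by a multiple of `δ²`, whereas its square is of order `τ²`. -/
lemma IsMixture.fisherInfoLoc_ge {F : ProbabilityMeasure ℝ} {δ : ℝ} (hδ : δ ∈ Ioc (0 : ℝ) 1)
    (B : ℝ) : ∀ᶠ τ in 𝓝[>] (0 : ℝ), ∀ G, IsMixture F (gaussLaw 0 τ) δ G →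
      ENNReal.ofReal B ≤ fisherInfoLoc G := by
  let b : ContDiffBump (0 : ℝ) := ⟨1, 2, one_pos, one_lt_two⟩
  have hbc : ContDiff ℝ 1 b := b.contDiff
  set ψ : ℝ → ℝ := fun x => x * b x with hψ
  have hψd : ContDiff ℝ 1 ψ := contDiff_id.mul hbc
  have hψs : HasCompactSupport ψ := b.hasCompactSupport.mul_left
  have hψc := hψd.continuous
  have hdc := hψd.continuous_deriv le_rfl
  obtain ⟨C, hC⟩ := exists_abs_le_of_hasCompactSupport hψc hψs
  obtain ⟨C', hC'⟩ := exists_abs_le_of_hasCompactSupport hdc hψs.deriv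
  have hψ0 : deriv ψ 0 = 1 := by
    have := (hasDerivAt_id (0 : ℝ)).mul ((hbc.differentiable one_ne_zero) 0).hasDerivAt
    have h1 : b (0 : ℝ) = 1 := b.one_of_mem_closedBall (by simp [b])
    refine this.deriv.trans ?_
    simp [h1]
  set c := ∫ x, deriv ψ x ∂gaussianReal 0 1 with hc
  have hcpos : 0 < c := by
    have hx : ∀ x, |x * ψ x| ≤ _ :=
      (exists_abs_le_of_hasCompactSupport (continuous_id.mul hψc) hψs.mul_left).choose_spec
    -- The sign of `ψ'` varies, but Stein's identity rewrites the integral as that of `x ψ(x) = x²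
    -- b(x) ≥ 0`.
    rw [hc, integral_deriv_gaussianReal (hψd.differentiable one_ne_zero)
      (hψc.integrable_of_bounded hC) (hdc.integrable_of_bounded hC')
      ((continuous_id.mul hψc).integrable_of_bounded hx)]
    refine integral_gaussianReal_pos (x := 1) (continuous_id.mul hψc) hψs.mul_left (fun x => ?_) ?_
    · simp only [hψ, Pi.zero_apply, ← mul_assoc]
      exact mul_nonneg (mul_self_nonneg x) b.nonneg
    · have h1 : b (1 : ℝ) = 1 := b.one_of_mem_closedBall (by simp [b])
      simp [hψ, h1]
  -- The contribution of `F` tends to `ψ'(0) = 1` times the mass of `F` at `0`. The limit is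
  -- nonnegative, so `F` cannot cancel the peak's contribution `δ * c`.
  have hlim : Tendsto (fun τ : ℝ => ∫ v, deriv ψ (v / τ) ∂(F : Measure ℝ)) (𝓝[>] 0)
      (𝓝 (∫ v, (if v = 0 then 1 else 0 : ℝ) ∂(F : Measure ℝ))) := by
    refine tendsto_integral_filter_of_dominated_convergence (fun _ => C')
      (Eventually.of_forall fun τ =>
        (hdc.comp (continuous_id.div_const τ)).aestronglyMeasurable)
      (Eventually.of_forall fun τ => ae_of_all _ fun v => hC' _) (integrable_const _)
      (ae_of_all _ fun v => ?_)
    by_cases hv : v = 0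
    · simp [hv, hψ0]
    · rw [if_neg hv]
      have h1 : Tendsto (fun τ : ℝ => v / τ) (𝓝[>] 0) (cocompact ℝ) := by
        rw [← Metric.cobounded_eq_cocompact, ← tendsto_norm_atTop_iff_cobounded]
        simp only [norm_div]
        have h2 : Tendsto (fun τ : ℝ => ‖τ‖) (𝓝[>] 0) (𝓝[>] 0) :=
          (tendsto_norm_nhdsNE_zero (E := ℝ)).mono_left (nhdsWithin_mono _ fun x hx => ne_of_gt hx)
        simp only [div_eq_mul_inv]
        exact (tendsto_inv_nhdsGT_zero.comp h2).const_mul_atTop (norm_pos_iff.2 hv)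
      exact hψs.deriv.is_zero_at_infty.comp h1
  have hge : 0 ≤ ∫ v, (if v = 0 then 1 else 0 : ℝ) ∂(F : Measure ℝ) :=
    integral_nonneg fun v => by positivity
  have ev1 : ∀ᶠ τ in 𝓝[>] (0 : ℝ), -(δ * c / 2) < ∫ v, deriv ψ (v / τ) ∂(F : Measure ℝ) :=
    hlim.eventually_const_lt (lt_of_lt_of_le (by have := mul_pos hδ.1 hcpos; linarith) hge)
  have ev2 : ∀ᶠ τ in 𝓝[>] (0 : ℝ), max B 0 * (τ ^ 2 * C ^ 2) < (δ * c / 2) ^ 2 := by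
    have h0 : 0 < δ * c / 2 := by have := mul_pos hδ.1 hcpos; linarith
    have : Tendsto (fun τ : ℝ => max B 0 * (τ ^ 2 * C ^ 2)) (𝓝[>] 0) (𝓝 0) := by
      refine Tendsto.mono_left ?_ nhdsWithin_le_nhds
      exact Continuous.tendsto' (by fun_prop) _ _ (by simp)
    exact this.eventually_lt_const (by positivity)
  filter_upwards [ev1, ev2, eventually_mem_nhdsWithin] with τ h1 h2 (hτ : 0 < τ) G hG
  by_contra! hlt
  have hle : fisherInfoLoc G ≤ ENNReal.ofReal (max B 0) :=
    hlt.le.trans (ENNReal.ofReal_le_ofReal (le_max_left _ _))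
  have hd : ∀ v, HasDerivAt (fun v => τ * ψ (v / τ)) (deriv ψ (v / τ)) v := by
    intro v
    have h3 : HasDerivAt (fun v => v / τ) (1 / τ) v := (hasDerivAt_id v).div_const τ
    have h4 := ((hψd.differentiable one_ne_zero (v / τ)).hasDerivAt.comp v h3).const_mul τ
    exact h4.congr_deriv (by field_simp)
  have hder : deriv (fun v => τ * ψ (v / τ)) = fun v => deriv ψ (v / τ) :=
    funext fun v => (hd v).deriv
  have hdc' : Continuous fun v => deriv ψ (v / τ) := hdc.comp (continuous_id.div_const τ)
  have := (fisherInfoLoc_le_iff (le_max_right B 0)).1 hle (fun v => τ * ψ (v / τ))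
    (contDiff_const.mul (hψd.comp (contDiff_id.div_const τ)))
    (HasCompactSupport.mul_left (f := fun _ => τ) (by
      simpa [div_eq_inv_mul] using hψs.comp_smul (c := τ⁻¹) (inv_ne_zero hτ.ne')))
  rw [hder, hG.integral_eq ⟨hδ.1.le, hδ.2⟩ (hdc'.integrable_of_bounded fun v => hC' _)
    (hdc'.integrable_of_bounded fun v => hC' _), integral_gaussLaw 0 τ hdc'] at this
  have h5 : ∀ x, (0 + τ * x) / τ = x := fun x => by field_simp; ring
  simp only [h5] at this
  have h6 : ∫ v, (τ * ψ (v / τ)) ^ 2 ∂(G : Measure ℝ) ≤ τ ^ 2 * C ^ 2 := by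
    refine (integral_mono_of_nonneg (ae_of_all _ fun _ => sq_nonneg _)
      (integrable_const (τ ^ 2 * C ^ 2)) (ae_of_all _ fun v => ?_)).trans (by simp)
    simp only [mul_pow]
    exact mul_le_mul_of_nonneg_left (sq_le_sq' (neg_le_of_abs_le (hC _)) (le_of_abs_le (hC _)))
      (sq_nonneg τ)
  have h7 : max B 0 * ∫ v, (τ * ψ (v / τ)) ^ 2 ∂(G : Measure ℝ) ≤ max B 0 * (τ ^ 2 * C ^ 2) :=
    mul_le_mul_of_nonneg_left h6 (le_max_right _ _)
  have h8 : δ * c / 2 ≤ (1 - δ) * ∫ v, deriv ψ (v / τ) ∂(F : Measure ℝ) + δ * c := by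
    have := mul_pos hδ.1 hcpos
    nlinarith [hδ.1, hδ.2]
  have h9 : (δ * c / 2) ^ 2 ≤
      ((1 - δ) * ∫ v, deriv ψ (v / τ) ∂(F : Measure ℝ) + δ * c) ^ 2 :=
    pow_le_pow_left₀ (by have := mul_pos hδ.1 hcpos; linarith) h8 2
  linarith

/-- Narrowing a normal law centred at `0` does not change its information of scale. The peaks are
therefore put at `1` and, for symmetry, at `-1`. The test function is a step of height of order `τ`
at `1`; only its derivative has compact support. -/
lemma IsMixture.fisherInfoScale_ge {F : ProbabilityMeasure ℝ} {δ : ℝ} (hδ : δ ∈ Ioc (0 : ℝ) 1)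
    (B : ℝ) : ∀ᶠ τ in 𝓝[>] (0 : ℝ), ∀ H G,
      IsMixture (gaussLaw 1 τ) (gaussLaw (-1) τ) (1 / 2) H → IsMixture F H δ G →
      ENNReal.ofReal B ≤ fisherInfoScale G := by
  let b : ContDiffBump (0 : ℝ) := ⟨1, 2, one_pos, one_lt_two⟩
  have hbc : Continuous b := b.continuous
  have hb0 : ∀ x, b x ≠ 0 → |x| < 2 := fun x hx => by
    have : x ∈ Metric.ball (0 : ℝ) 2 := by rw [← b.support_eq]; exact hx
    simpa using this
  set ψ : ℝ → ℝ := fun x => ∫ t in (0 : ℝ)..x, b t with hψ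
  have hψd : ∀ x, HasDerivAt ψ (b x) x := fun x =>
    intervalIntegral.integral_hasDerivAt_right (hbc.intervalIntegrable _ _)
      hbc.stronglyMeasurable.stronglyMeasurableAtFilter hbc.continuousAt
  have hψder : deriv ψ = b := funext fun x => (hψd x).deriv
  have hψ1 : ContDiff ℝ 1 ψ := by
    rw [contDiff_one_iff_deriv]
    exact ⟨fun x => (hψd x).differentiableAt, by rwa [hψder]⟩
  obtain ⟨C, hC⟩ := exists_abs_le_of_hasCompactSupport_deriv hψ1
    (by rw [hψder]; exact b.hasCompactSupport)
  set c := ∫ x, b x ∂gaussianReal 0 1 with hc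
  have hcpos : 0 < c := by
    refine integral_gaussianReal_pos (x := 0) hbc b.hasCompactSupport (fun x => b.nonneg) ?_
    have h1 : b (0 : ℝ) = 1 := b.one_of_mem_closedBall (by simp [b])
    simp [h1]
  have hδc : 0 < δ * c := mul_pos hδ.1 hcpos
  have ev2 : ∀ᶠ τ in 𝓝[>] (0 : ℝ), max B 0 * (τ ^ 2 * C ^ 2) < (δ * c / 4) ^ 2 := by
    have : Tendsto (fun τ : ℝ => max B 0 * (τ ^ 2 * C ^ 2)) (𝓝[>] 0) (𝓝 0) := by
      refine Tendsto.mono_left ?_ nhdsWithin_le_nhds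
      exact Continuous.tendsto' (by fun_prop) _ _ (by simp)
    exact this.eventually_lt_const (by positivity)
  -- For `τ ≤ 1 / 4` the derivative lives on `v ≥ 1 / 2`. So `F` and the peak at `-1` contribute
  -- nonnegatively, and the peak at `1`, of weight `δ / 2`, contributes at least `δ * c / 4`.
  filter_upwards [ev2, Ioc_mem_nhdsGT (show (0 : ℝ) < 1 / 4 by norm_num)] with τ h2 hτ H G hH hG
  by_contra! hlt
  have hle : fisherInfoScale G ≤ ENNReal.ofReal (max B 0) :=
    hlt.le.trans (ENNReal.ofReal_le_ofReal (le_max_left _ _))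
  have hd : ∀ v, HasDerivAt (fun v => τ * ψ ((v - 1) / τ)) (b ((v - 1) / τ)) v := by
    intro v
    have h3 : HasDerivAt (fun v => (v - 1) / τ) (1 / τ) v :=
      ((hasDerivAt_id v).sub_const 1).div_const τ
    have h4 := ((hψd ((v - 1) / τ)).comp v h3).const_mul τ
    have := hτ.1.ne'
    exact h4.congr_deriv (by field_simp)
  have hder : deriv (fun v => τ * ψ ((v - 1) / τ)) = fun v => b ((v - 1) / τ) :=
    funext fun v => (hd v).deriv
  have hdc : Continuous fun v => v * b ((v - 1) / τ) := by fun_prop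
  have hds : HasCompactSupport fun v => b ((v - 1) / τ) := by
    refine HasCompactSupport.intro (isCompact_Icc (a := 1 - 2 * τ) (b := 1 + 2 * τ)) fun v hv => ?_
    by_contra h
    have := hb0 _ h
    rw [abs_div, abs_of_pos hτ.1, div_lt_iff₀ hτ.1, abs_lt] at this
    exact hv ⟨by linarith [this.1], by linarith [this.2]⟩
  obtain ⟨C', hC'⟩ := exists_abs_le_of_hasCompactSupport hdc hds.mul_left
  have hpos : ∀ v, 0 ≤ v * b ((v - 1) / τ) := by
    intro v
    by_cases h : b ((v - 1) / τ) = 0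
    · simp [h]
    · have := hb0 _ h
      rw [abs_div, abs_of_pos hτ.1, div_lt_iff₀ hτ.1, abs_lt] at this
      exact mul_nonneg (by linarith [this.1, hτ.2]) b.nonneg
  have := (fisherInfoScale_le_iff (le_max_right B 0)).1 hle (fun v => τ * ψ ((v - 1) / τ))
    (contDiff_const.mul (hψ1.comp ((contDiff_id.sub contDiff_const).div_const τ)))
    (by rw [hder]; exact hds)
  have hi : ∀ P : ProbabilityMeasure ℝ, Integrable (fun v => v * b ((v - 1) / τ)) (P : Measure ℝ) :=
    fun P => hdc.integrable_of_bounded hC'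
  rw [hder, hG.integral_eq ⟨hδ.1.le, hδ.2⟩ (hi F) (hi H),
    hH.integral_eq ⟨by norm_num, by norm_num⟩ (hi _) (hi _), integral_gaussLaw 1 τ hdc] at this
  have h6 : ∫ v, (τ * ψ ((v - 1) / τ)) ^ 2 ∂(G : Measure ℝ) ≤ τ ^ 2 * C ^ 2 := by
    refine (integral_mono_of_nonneg (ae_of_all _ fun _ => sq_nonneg _)
      (integrable_const (τ ^ 2 * C ^ 2)) (ae_of_all _ fun v => ?_)).trans (by simp)
    simp only [mul_pow]
    exact mul_le_mul_of_nonneg_left (sq_le_sq' (neg_le_of_abs_le (hC _)) (le_of_abs_le (hC _)))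
      (sq_nonneg τ)
  have h7 := mul_le_mul_of_nonneg_left h6 (le_max_right B 0)
  have hF0 : 0 ≤ ∫ v, v * b ((v - 1) / τ) ∂(F : Measure ℝ) := integral_nonneg hpos
  have hm0 : 0 ≤ ∫ v, v * b ((v - 1) / τ) ∂(gaussLaw (-1) τ : Measure ℝ) := integral_nonneg hpos
  have hp : c / 2 ≤ ∫ x, (1 + τ * x) * b ((1 + τ * x - 1) / τ) ∂gaussianReal 0 1 := by
    have h5 : ∀ x, (1 + τ * x - 1) / τ = x := fun x => by
      have := hτ.1.ne'
      field_simp; ring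
    simp only [h5]
    rw [hc, ← integral_div]
    obtain ⟨D, hD⟩ := exists_abs_le_of_hasCompactSupport (φ := fun x => (1 + τ * x) * b x)
      (by fun_prop) b.hasCompactSupport.mul_left
    obtain ⟨E, hE⟩ := exists_abs_le_of_hasCompactSupport hbc b.hasCompactSupport
    refine integral_mono ((hbc.integrable_of_bounded hE).div_const 2)
      ((by fun_prop : Continuous fun x => (1 + τ * x) * b x).integrable_of_bounded hD) fun x => ?_
    by_cases h : b x = 0
    · simp [h]
    · have h3 := abs_lt.1 (hb0 _ h)
      have h4 : 1 / 2 ≤ 1 + τ * x := by nlinarith [h3.1, hτ.1, hτ.2]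
      have := mul_le_mul_of_nonneg_right h4 (b.nonneg (x := x))
      dsimp only
      linarith
  have h9 : δ * c / 4 ≤ (1 - δ) * ∫ v, v * b ((v - 1) / τ) ∂(F : Measure ℝ) +
      δ * ((1 - 1 / 2) * ∫ x, (1 + τ * x) * b ((1 + τ * x - 1) / τ) ∂gaussianReal 0 1 +
        1 / 2 * ∫ v, v * b ((v - 1) / τ) ∂(gaussLaw (-1) τ : Measure ℝ)) := by
    have e1 := mul_nonneg (show 0 ≤ 1 - δ by linarith [hδ.2]) hF0
    have e2 := mul_le_mul_of_nonneg_left hp hδ.1.le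
    have e3 := mul_nonneg hδ.1.le hm0
    linarith
  have h10 := pow_le_pow_left₀ (by linarith) h9 2
  linarith

/-! ### Laws of finitely many independent observations -/

/-- The product outer measure is the largest one bounded on boxes by the product of the side
measures, so the comparison is needed on boxes only. -/
lemma Measure.pow_smul_pi_le {ι : Type*} [Fintype ι] {α : Type*} [MeasurableSpace α]
    {μ ν : Measure α} [SigmaFinite μ] [SigmaFinite ν] {c : ℝ≥0∞} (h : c • μ ≤ ν) :
    c ^ Fintype.card ι • Measure.pi (fun _ : ι => μ) ≤ Measure.pi fun _ : ι => ν := by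
  have h1 : (c ^ Fintype.card ι • Measure.pi (fun _ : ι => μ)).toOuterMeasure ≤
      OuterMeasure.pi fun _ : ι => ν.toOuterMeasure := by
    refine OuterMeasure.le_pi.2 fun s _ => ?_
    change (c ^ Fintype.card ι • Measure.pi (fun _ : ι => μ)) (univ.pi s) ≤ ∏ i, ν (s i)
    rw [Measure.smul_apply, Measure.pi_pi, smul_eq_mul, ← Finset.card_univ, ← Finset.prod_const,
      ← Finset.prod_mul_distrib]
    exact Finset.prod_le_prod' fun i _ => h (s i)
  refine Measure.le_iff.2 fun s hs => ?_
  rw [Measure.pi_def (fun _ : ι => ν), toMeasure_apply _ _ hs]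
  exact h1 s

lemma Measure.smul_map_le {α β : Type*} [MeasurableSpace α] [MeasurableSpace β] {μ ν : Measure α}
    {c : ℝ≥0∞} (h : c • μ ≤ ν) {f : α → β} (hf : Measurable f) : c • μ.map f ≤ ν.map f := by
  rw [← Measure.map_smul]
  exact Measure.map_mono h hf

lemma IsMixture.smul_le {F H G : ProbabilityMeasure ℝ} {δ : ℝ} (hG : IsMixture F H δ G) :
    ENNReal.ofReal (1 - δ) • (F : Measure ℝ) ≤ G := by
  rw [hG]
  exact Measure.le_add_right le_rfl

/-- Domination is applied to the complement of `A`. -/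
lemma measureReal_le_add_of_smul_le {α : Type*} [MeasurableSpace α] {μ ν : Measure α}
    [IsProbabilityMeasure μ] [IsProbabilityMeasure ν] {c : ℝ} (hc : c ∈ Icc (0 : ℝ) 1)
    (h : ENNReal.ofReal c • μ ≤ ν) {A : Set α} (hA : MeasurableSet A) :
    ν.real A ≤ μ.real A + (1 - c) := by
  have h1 : c * μ.real Aᶜ ≤ ν.real Aᶜ := by
    have := ENNReal.toReal_mono (measure_ne_top _ _) (h Aᶜ)
    rwa [Measure.smul_apply, smul_eq_mul, ENNReal.toReal_mul, ENNReal.toReal_ofReal hc.1] at this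
  rw [probReal_compl_eq_one_sub hA, probReal_compl_eq_one_sub hA] at h1
  have h2 : 0 ≤ μ.real A := measureReal_nonneg
  nlinarith [hc.1, hc.2]

lemma one_sub_pow_le {δ η : ℝ} (m : ℕ) (hδ : δ ∈ Icc (0 : ℝ) 1)
    (h : δ ≤ η / (m + 1)) : 1 - (1 - δ) ^ m ≤ η := by
  have h1 := one_add_mul_le_pow (show -2 ≤ -δ by linarith [hδ.2]) m
  rw [le_div_iff₀ (by positivity)] at h
  rw [← sub_eq_add_neg] at h1
  nlinarith [hδ.1]

namespace ErrorModel

variable {ι Y : Type} [MeasurableSpace Y]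

/-- The domination does not depend on `H`. Hence `δ` can be fixed first, from `η` and the number `m`
of errors involved, and `H` sharpened afterwards. -/
lemma contaminable_of_smul_le {M : ErrorModel ι Y} {lam : ProbabilityMeasure ℝ → ℝ}
    {F : ProbabilityMeasure ℝ} {n : ℕ} {D : Set (Fin n → Y)} (hD : MeasurableSet D) (m : ℕ)
    (hlaw : ∀ H G δ, IsMixture F H δ G → ENNReal.ofReal (1 - δ) ^ m •
      (M.law F n : Measure (Fin n → Y)) ≤ M.law G n)
    (hlam : ∀ δ ∈ Ioc (0 : ℝ) (1 / 2), ∀ B, ∃ H ∈ M.errors, IsSymmetricLaw H ∧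
      ∀ G, IsMixture F H δ G → B ≤ lam G) : M.Contaminable lam F n D := by
  intro B η hη
  refine ⟨min (η / (m + 1)) (1 / 2), by positivity, fun δ hδ hδm => ?_⟩
  obtain ⟨H, hH, hs, hB⟩ := hlam δ ⟨hδ.1, hδm.trans (min_le_right _ _)⟩ B
  refine ⟨H, hH, hs, fun G hG => ⟨hB G hG, ?_⟩⟩
  have hδ0 : 0 ≤ 1 - δ := by linarith [hδ.2]
  have h1 := hlaw H G δ hG
  rw [← ENNReal.ofReal_pow hδ0] at h1
  have h2 := measureReal_le_add_of_smul_le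
    ⟨pow_nonneg hδ0 m, pow_le_one₀ hδ0 (by linarith [hδ.1])⟩ h1 hD
  linarith [one_sub_pow_le m ⟨hδ.1.le, hδ.2⟩ (hδm.trans (min_le_left _ _))]

end ErrorModel

/-! ### Location, scale and regression -/

/-- Finiteness is essential here, since `toReal` sends `∞` to `0`. The bound `τ ≤ 1` later keeps
first moments uniformly bounded. -/
lemma exists_gaussLaw_le_fisherInfoLoc {F : ProbabilityMeasure ℝ} (hF : fisherInfoLoc F < ∞)
    {δ : ℝ} (hδ : δ ∈ Ioc (0 : ℝ) 1) (B : ℝ) : ∃ τ ∈ Ioc (0 : ℝ) 1,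
      ∀ G, IsMixture F (gaussLaw 0 τ) δ G → B ≤ (fisherInfoLoc G).toReal := by
  obtain ⟨τ, hB, hτ⟩ :=
    ((IsMixture.fisherInfoLoc_ge (F := F) hδ B).and (Ioc_mem_nhdsGT one_pos)).exists
  refine ⟨τ, hτ, fun G hG => ?_⟩
  have hfin := fisherInfoLoc_mixture_lt_top ⟨hδ.1.le, hδ.2⟩ hG hF
    (fisherInfoLoc_gaussLaw_lt_top 0 hτ.1)
  exact (ENNReal.ofReal_le_iff_le_toReal hfin.ne).1 (hB G hG)

theorem nonuniform_locationModel (θ : ℝ) {F : ProbabilityMeasure ℝ}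
    (hF : F ∈ (locationModel θ).errors) {S : (n : ℕ) → (Fin n → ℝ) → Fin 1 → ℝ}
    (hS : ∀ n, Measurable (S n)) (hN : (locationModel θ).AsymptoticallyNormal F S) :
    (locationModel θ).Nonuniform F S := by
  refine ErrorModel.nonuniform_of_contaminable hS (A := 1)
    (lam := fun G => (fisherInfoLoc G).toReal) (fun _ => rfl) ENNReal.toReal_nonneg
    (fun H hH δ hδ G hG => fisherInfoLoc_mixture_lt_top hδ hG hF hH) (fun n u => ?_) hN
  refine ErrorModel.contaminable_of_smul_le
    (ErrorModel.measurable_standardized _ F (hS n) measurableSet_Iic) n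
    (fun H G δ hG => ?_) fun δ hδ B => ?_
  · have h := Measure.pow_smul_pi_le (ι := Fin n)
      (Measure.smul_map_le hG.smul_le (f := fun v => θ + v) (by fun_prop))
    rwa [Fintype.card_fin] at h
  · obtain ⟨τ, hτ, h⟩ := exists_gaussLaw_le_fisherInfoLoc hF ⟨hδ.1, by linarith [hδ.2]⟩ B
    exact ⟨_, fisherInfoLoc_gaussLaw_lt_top 0 hτ.1, isSymmetricLaw_gaussLaw τ, h⟩

theorem nonuniform_regressionModel {d : ℕ} (K : ProbabilityMeasure (Fin d → ℝ)) (θ : Fin d → ℝ)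
    {F : ProbabilityMeasure ℝ} (hF : F ∈ (regressionModel K θ).errors)
    {S : (n : ℕ) → (Fin n → (Fin d → ℝ) × ℝ) → Fin d → ℝ} (hS : ∀ n, Measurable (S n))
    (hN : (regressionModel K θ).AsymptoticallyNormal F S) :
    (regressionModel K θ).Nonuniform F S := by
  refine ErrorModel.nonuniform_of_contaminable hS (A := secondMoment K)
    (lam := fun G => (fisherInfoLoc G).toReal) (fun _ => rfl) ENNReal.toReal_nonneg
    (fun H hH δ hδ G hG => fisherInfoLoc_mixture_lt_top hδ hG hF hH) (fun n u => ?_) hN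
  refine ErrorModel.contaminable_of_smul_le
    (ErrorModel.measurable_standardized _ F (hS n) measurableSet_Iic) n
    (fun H G δ hG => ?_) fun δ hδ B => ?_
  · have h0 : ENNReal.ofReal (1 - δ) • (K : Measure (Fin d → ℝ)).prod (F : Measure ℝ) ≤
        (K : Measure (Fin d → ℝ)).prod G := by
      rw [hG, Measure.prod_add, Measure.prod_smul_right]
      exact Measure.le_add_right le_rfl
    have h := Measure.pow_smul_pi_le (ι := Fin n)
      (Measure.smul_map_le h0 (f := fun z : (Fin d → ℝ) × ℝ => (z.1, z.1 ⬝ᵥ θ + z.2))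
        (by unfold dotProduct; fun_prop))
    rwa [Fintype.card_fin] at h
  · obtain ⟨τ, hτ, h⟩ := exists_gaussLaw_le_fisherInfoLoc hF ⟨hδ.1, by linarith [hδ.2]⟩ B
    exact ⟨_, fisherInfoLoc_gaussLaw_lt_top 0 hτ.1, isSymmetricLaw_gaussLaw τ, h⟩

theorem nonuniform_scaleModel (σ : ℝ) {F : ProbabilityMeasure ℝ}
    (hF : F ∈ (scaleModel σ).errors) {S : (n : ℕ) → (Fin n → ℝ) → Fin 1 → ℝ}
    (hS : ∀ n, Measurable (S n)) (hN : (scaleModel σ).AsymptoticallyNormal F S) :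
    (scaleModel σ).Nonuniform F S := by
  refine ErrorModel.nonuniform_of_contaminable hS (A := (σ ^ 2)⁻¹ • 1)
    (lam := fun G => (fisherInfoScale G).toReal) (fun _ => rfl) ENNReal.toReal_nonneg
    (fun H hH δ hδ G hG => fisherInfoScale_mixture_lt_top hδ hG hF hH) (fun n u => ?_) hN
  refine ErrorModel.contaminable_of_smul_le
    (ErrorModel.measurable_standardized _ F (hS n) measurableSet_Iic) n
    (fun H G δ hG => ?_) fun δ hδ B => ?_
  · have h := Measure.pow_smul_pi_le (ι := Fin n)
      (Measure.smul_map_le hG.smul_le (f := fun v => σ * v) (by fun_prop))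
    rwa [Fintype.card_fin] at h
  · have hδ1 : δ ≤ 1 := by linarith [hδ.2]
    obtain ⟨τ, hB, hτ⟩ :=
      ((IsMixture.fisherInfoScale_ge (F := F) ⟨hδ.1, hδ1⟩ B).and (Ioc_mem_nhdsGT one_pos)).exists
    have h2 : (1 / 2 : ℝ) ∈ Icc (0 : ℝ) 1 := by norm_num
    obtain ⟨H, hH⟩ := exists_isMixture (gaussLaw 1 τ) (gaussLaw (-1) τ) h2
    have hfinH := fisherInfoScale_mixture_lt_top h2 hH
      (fisherInfoScale_gaussLaw_lt_top 1 hτ.1) (fisherInfoScale_gaussLaw_lt_top (-1) hτ.1)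
    refine ⟨H, hfinH, ?_, fun G hG => ?_⟩
    · unfold IsSymmetricLaw
      rw [hH, Measure.map_add _ _ measurable_neg, Measure.map_smul, Measure.map_smul,
        map_neg_gaussLaw, map_neg_gaussLaw, neg_neg, add_comm]
      norm_num
    · exact (ENNReal.ofReal_le_iff_le_toReal
        (fisherInfoScale_mixture_lt_top ⟨hδ.1.le, hδ1⟩ hG hF hfinH).ne).1 (hB H G hH hG)

/-! ### Absolutely summable power series -/

lemma PowerSeries.summable_norm_coeff_mul {R : Type*} [NormedCommRing R] {f g : PowerSeries R}
    (hf : Summable fun n => ‖coeff n f‖) (hg : Summable fun n => ‖coeff n g‖) :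
    Summable fun n => ‖coeff n (f * g)‖ := by
  simp only [coeff_mul]
  exact summable_norm_sum_mul_antidiagonal_of_summable_norm (f := fun n => coeff n f)
    (g := fun n => coeff n g) hf hg

lemma Polynomial.summable_norm_coeff {R : Type*} [NormedCommRing R] (f : Polynomial R) :
    Summable fun n => ‖PowerSeries.coeff n (f : PowerSeries R)‖ := by
  refine summable_of_ne_finset_zero (s := f.support) fun n hn => ?_
  rw [Polynomial.coeff_coe, Polynomial.notMem_support_iff.1 hn, norm_zero]

lemma exists_summable_inverse_X_sub_C {r : ℂ} (hr : 1 < ‖r‖) : ∃ a : PowerSeries ℂ,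
    (Summable fun n => ‖PowerSeries.coeff n a‖) ∧
      ((Polynomial.X - Polynomial.C r : Polynomial ℂ) : PowerSeries ℂ) * a = 1 := by
  have hr0 : r ≠ 0 := by rintro rfl; simp at hr; linarith
  refine ⟨PowerSeries.mk fun n => -(r⁻¹) ^ (n + 1), ?_, ?_⟩
  · simp only [PowerSeries.coeff_mk, norm_neg, norm_pow, norm_inv]
    exact (summable_nat_add_iff 1).2
      (summable_geometric_of_lt_one (by positivity) (inv_lt_one_of_one_lt₀ hr))
  · ext n
    rw [Polynomial.coe_sub, Polynomial.coe_X, Polynomial.coe_C, sub_mul, map_sub,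
      PowerSeries.coeff_C_mul, PowerSeries.coeff_mk, PowerSeries.coeff_one]
    cases n with
    | zero => simp [hr0]
    | succ n =>
      rw [PowerSeries.coeff_succ_X_mul, PowerSeries.coeff_mk, if_neg (Nat.succ_ne_zero n),
        pow_succ (r⁻¹) (n + 1)]
      field_simp
      ring

/-- All roots lie outside the closed unit disc; each linear factor is inverted by a geometric
series, and products of absolutely summable series are absolutely summable. -/
lemma exists_summable_inverse (P : Polynomial ℂ) (hP : ∀ z : ℂ, ‖z‖ ≤ 1 → P.eval z ≠ 0) :
    ∃ a : PowerSeries ℂ, (Summable fun n => ‖PowerSeries.coeff n a‖) ∧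
      (P : PowerSeries ℂ) * a = 1 := by
  have key : ∀ s : Multiset ℂ, (∀ r ∈ s, 1 < ‖r‖) → ∃ a : PowerSeries ℂ,
      (Summable fun n => ‖PowerSeries.coeff n a‖) ∧
        (((s.map fun r => Polynomial.X - Polynomial.C r).prod : Polynomial ℂ) :
          PowerSeries ℂ) * a = 1 := by
    intro s
    induction s using Multiset.induction with
    | empty =>
      intro _
      refine ⟨1, ?_, by simp⟩
      simpa using Polynomial.summable_norm_coeff (1 : Polynomial ℂ)
    | cons r s ih =>
      intro hs
      obtain ⟨a, ha, ha1⟩ := ih fun r hr => hs r (Multiset.mem_cons_of_mem hr)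
      obtain ⟨b, hb, hb1⟩ := exists_summable_inverse_X_sub_C (hs r (Multiset.mem_cons_self r s))
      refine ⟨b * a, PowerSeries.summable_norm_coeff_mul hb ha, ?_⟩
      rw [Multiset.map_cons, Multiset.prod_cons, Polynomial.coe_mul, mul_mul_mul_comm, hb1, ha1,
        mul_one]
  have hP0 : P ≠ 0 := by
    rintro rfl
    exact hP 0 (by simp) (by simp)
  obtain ⟨a, ha, ha1⟩ := key P.roots fun r hr => by
    by_contra! h
    exact hP r h (Polynomial.isRoot_of_mem_roots hr)
  have hlead : P.leadingCoeff ≠ 0 := Polynomial.leadingCoeff_ne_zero.2 hP0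
  refine ⟨PowerSeries.C P.leadingCoeff⁻¹ * a, ?_, ?_⟩
  · simp only [PowerSeries.coeff_C_mul, norm_mul]
    exact ha.mul_left _
  · have hs := (IsAlgClosed.splits P).eq_prod_roots
    calc (P : PowerSeries ℂ) * (PowerSeries.C P.leadingCoeff⁻¹ * a)
        = ((Polynomial.C P.leadingCoeff * (P.roots.map fun r => Polynomial.X -
          Polynomial.C r).prod : Polynomial ℂ) : PowerSeries ℂ) *
            (PowerSeries.C P.leadingCoeff⁻¹ * a) := by rw [← hs]
      _ = 1 := ?_
    rw [Polynomial.coe_mul, Polynomial.coe_C, mul_mul_mul_comm, ha1, ← map_mul,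
      mul_inv_cancel₀ hlead]
    simp

lemma constantCoeff_lagPoly {p : ℕ} (a : Fin p → ℝ) :
    PowerSeries.constantCoeff (lagPoly a : PowerSeries ℝ) = 1 := by
  simp [lagPoly, Polynomial.coeff_X_pow]

lemma summable_norm_coeff_lagInv {p : ℕ} (a : Fin p → ℝ)
    (ha : ∀ z : ℂ, ‖z‖ ≤ 1 → Polynomial.aeval z (lagPoly a) ≠ 0) :
    Summable fun n => ‖PowerSeries.coeff n (lagInv a)‖ := by
  obtain ⟨b, hb, hb1⟩ := exists_summable_inverse ((lagPoly a).map (algebraMap ℝ ℂ))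
    fun z hz => by rw [Polynomial.eval_map_algebraMap]; exact ha z hz
  have h1 : (lagPoly a : PowerSeries ℝ) * lagInv a = 1 :=
    PowerSeries.mul_inv_cancel _ (by rw [constantCoeff_lagPoly]; exact one_ne_zero)
  have h2 := congrArg (PowerSeries.map (algebraMap ℝ ℂ)) h1
  rw [map_mul, map_one, ← Polynomial.polynomial_map_coe] at h2
  have h3 : PowerSeries.map (algebraMap ℝ ℂ) (lagInv a) = b := by
    calc _ = b * ((((lagPoly a).map (algebraMap ℝ ℂ) : Polynomial ℂ) : PowerSeries ℂ) *
        PowerSeries.map (algebraMap ℝ ℂ) (lagInv a)) := by rw [← mul_assoc, mul_comm b, hb1, one_mul]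
      _ = b := by rw [h2, mul_one]
  rw [← h3] at hb
  simpa using hb

lemma ArmaRegular.summable_coeff {p q : ℕ} {φ : Fin p → ℝ} {ξ : Fin q → ℝ}
    (h : ArmaRegular φ ξ) :
    Summable fun j => ‖PowerSeries.coeff j (lagInv φ * (lagPoly ξ : PowerSeries ℝ))‖ :=
  PowerSeries.summable_norm_coeff_mul
    (summable_norm_coeff_lagInv φ fun z hz => left_ne_zero_of_mul (h.1 z hz))
    (Polynomial.summable_norm_coeff _)

/-! ### Functions of finitely many innovations -/

/-- Such an `X` factors through the restriction to `I`, where the infinite product projects to a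
finite one. The exponent is the number of innovations involved. -/
lemma pow_smul_map_infinitePi_le {Z : Type*} [MeasurableSpace Z] {μ ν : Measure ℝ}
    [IsProbabilityMeasure μ] [IsProbabilityMeasure ν] {c : ℝ≥0∞} (h : c • μ ≤ ν)
    {X : (ℤ → ℝ) → Z} (hX : Measurable X) (I : Finset ℤ)
    (hI : ∀ v w : ℤ → ℝ, (∀ t ∈ I, v t = w t) → X v = X w) :
    c ^ I.card • (Measure.infinitePi fun _ : ℤ => μ).map X ≤
      (Measure.infinitePi fun _ : ℤ => ν).map X := by
  let e : (I → ℝ) → ℤ → ℝ := fun w t => if ht : t ∈ I then w ⟨t, ht⟩ else 0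
  have he : Measurable e := measurable_pi_lambda _ fun t => by
    by_cases ht : t ∈ I
    · simp only [e, ht, dite_true]; fun_prop
    · simp only [e, ht, dite_false]; fun_prop
  have hXe : X = (X ∘ e) ∘ I.restrict := by
    funext v
    refine hI _ _ fun t ht => ?_
    simp [e, ht]
  have hr : Measurable (I.restrict : (ℤ → ℝ) → (I → ℝ)) := Finset.measurable_restrict I
  rw [hXe, ← Measure.map_map (hX.comp he) hr, ← Measure.map_map (hX.comp he) hr,
    Measure.infinitePi_map_restrict, Measure.infinitePi_map_restrict]
  have := Measure.smul_map_le (Measure.pow_smul_pi_le (ι := I) h) (hX.comp he)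
  rwa [Fintype.card_coe] at this

/-- The process `∑_{j < N} c_j V_{t-j}` where `c_j` are the coefficients of `φ⁻¹ ξ`. -/
noncomputable def armaTruncation {p q : ℕ} (φ : Fin p → ℝ) (ξ : Fin q → ℝ) (N : ℕ) (t : ℤ)
    (v : ℤ → ℝ) : ℝ :=
  ∑ j ∈ Finset.range N, PowerSeries.coeff j (lagInv φ * (lagPoly ξ : PowerSeries ℝ)) * v (t - j)

section Arma

variable {p q : ℕ} (φ : Fin p → ℝ) (ξ : Fin q → ℝ)

lemma measurable_armaTruncation_vec (N n : ℕ) : Measurable fun (v : ℤ → ℝ) (i : Fin n) =>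
    armaTruncation φ ξ N ((i.val : ℤ) + 1) v := by
  unfold armaTruncation
  fun_prop

lemma measurable_armaProcess_vec (n : ℕ) : Measurable fun (v : ℤ → ℝ) (i : Fin n) =>
    armaProcess φ ξ ((i.val : ℤ) + 1) v :=
  measurable_pi_lambda _ fun _ => measurable_armaProcess φ ξ _

lemma armaTruncation_congr {N n : ℕ} {v w : ℤ → ℝ}
    (h : ∀ t ∈ Finset.Icc (-(N : ℤ)) n, v t = w t) (i : Fin n) :
    armaTruncation φ ξ N ((i.val : ℤ) + 1) v = armaTruncation φ ξ N ((i.val : ℤ) + 1) w := by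
  unfold armaTruncation
  refine Finset.sum_congr rfl fun j hj => ?_
  have := Finset.mem_range.1 hj
  have := i.isLt
  rw [h _ (Finset.mem_Icc.2 ⟨by omega, by omega⟩)]

lemma toMeasure_armaModel_law (F : ProbabilityMeasure ℝ) (n : ℕ) :
    ((armaModel φ ξ).law F n : Measure (Fin n → ℝ)) =
      (Measure.infinitePi fun _ : ℤ => (F : Measure ℝ)).map
        fun v i => armaProcess φ ξ ((i.val : ℤ) + 1) v := rfl

lemma enorm_armaProcess_sub_le (N : ℕ) (t : ℤ) (v : ℤ → ℝ) :
    ‖ armaProcess φ ξ t v - armaTruncation φ ξ N t v‖ₑ ≤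
      ∑' j : ℕ, ‖PowerSeries.coeff (j + N) (lagInv φ * (lagPoly ξ : PowerSeries ℝ))‖ₑ *
        ‖v (t - (j + N : ℕ))‖ₑ := by
  set f : ℕ → ℝ := fun j =>
    PowerSeries.coeff j (lagInv φ * (lagPoly ξ : PowerSeries ℝ)) * v (t - j) with hf
  have hR : (∑' j : ℕ, ‖PowerSeries.coeff (j + N) (lagInv φ * (lagPoly ξ : PowerSeries ℝ))‖ₑ *
        ‖v (t - (j + N : ℕ))‖ₑ) = ∑' j, ‖f (j + N)‖ₑ := by simp only [hf, enorm_mul]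
  rw [hR]
  -- No summability is assumed along `v`: either the bound is infinite, or the series converges
  -- absolutely and its `tsum` is not a default value.
  by_cases htop : ∑' j, ‖f (j + N)‖ₑ = ∞
  · rw [htop]; exact le_top
  · have hs1 : Summable fun j => f (j + N) := by
      refine Summable.of_norm ?_
      have := ENNReal.summable_toReal htop
      simpa using this
    have hs : Summable f := (summable_nat_add_iff N).1 hs1
    have : armaProcess φ ξ t v - armaTruncation φ ξ N t v = ∑' j, f (j + N) := by
      rw [sub_eq_iff_eq_add']
      exact (hs.sum_add_tsum_nat_add N).symm
    rw [this]
    exact enorm_tsum_le_tsum_enorm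

lemma lintegral_enorm_armaProcess_sub_le (G : ProbabilityMeasure ℝ) (N : ℕ) (t : ℤ) :
    ∫⁻ v, ‖ armaProcess φ ξ t v - armaTruncation φ ξ N t v‖ₑ
        ∂(Measure.infinitePi fun _ : ℤ => (G : Measure ℝ)) ≤
      (∑' j : ℕ, ‖PowerSeries.coeff (j + N) (lagInv φ * (lagPoly ξ : PowerSeries ℝ))‖ₑ) *
        ∫⁻ x, ‖x‖ₑ ∂(G : Measure ℝ) := by
  refine (lintegral_mono fun v => enorm_armaProcess_sub_le φ ξ N t v).trans ?_
  rw [lintegral_tsum (fun j => ((measurable_pi_apply _).enorm.const_mul _).aemeasurable), ← ENNReal.tsum_mul_right]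
  refine ENNReal.tsum_le_tsum fun j => ?_
  rw [lintegral_const_mul _ (measurable_pi_apply _).enorm]
  have := (measurePreserving_eval_infinitePi (fun _ : ℤ => (G : Measure ℝ))
    (t - (j + N : ℕ))).lintegral_comp (f := fun x : ℝ => ‖x‖ₑ) (by fun_prop)
  simp only [Function.eval] at this
  rw [this]

lemma measure_dist_armaProcess_gt_le (G : ProbabilityMeasure ℝ) (N n : ℕ) {r : ℝ} (hr : 0 < r) :
    (Measure.infinitePi fun _ : ℤ => (G : Measure ℝ)) {v | r <
        dist (fun i : Fin n => armaProcess φ ξ ((i.val : ℤ) + 1) v)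
          (fun i : Fin n => armaTruncation φ ξ N ((i.val : ℤ) + 1) v)} ≤
      n * ((∑' j : ℕ, ‖PowerSeries.coeff (j + N) (lagInv φ * (lagPoly ξ : PowerSeries ℝ))‖ₑ) *
        ∫⁻ x, ‖x‖ₑ ∂(G : Measure ℝ)) / ENNReal.ofReal r := by
  have hm : ∀ i : Fin n, Measurable fun v : ℤ → ℝ => ‖ armaProcess φ ξ ((i.val : ℤ) + 1) v -
      armaTruncation φ ξ N ((i.val : ℤ) + 1) v‖ₑ := fun i =>
    (((measurable_pi_apply i).comp (measurable_armaProcess_vec φ ξ n)).sub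
      ((measurable_pi_apply i).comp (measurable_armaTruncation_vec φ ξ N n))).enorm
  refine (measure_mono (t := {v | ENNReal.ofReal r ≤ ∑ i : Fin n,
    ‖ armaProcess φ ξ ((i.val : ℤ) + 1) v - armaTruncation φ ξ N ((i.val : ℤ) + 1) v‖ₑ})
    fun v hv => ?_).trans ?_
  · by_contra h
    simp only [mem_ofPred_eq, not_le] at h hv
    refine hv.not_ge ((dist_pi_le_iff hr.le).2 fun i => ?_)
    have h1 := (Finset.single_le_sum (f := fun i : Fin n => ‖ armaProcess φ ξ ((i.val : ℤ) + 1) v -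
      armaTruncation φ ξ N ((i.val : ℤ) + 1) v‖ₑ) (fun _ _ => zero_le)
      (Finset.mem_univ i)).trans h.le
    rw [← ofReal_norm, ENNReal.ofReal_le_ofReal_iff hr.le] at h1
    exact h1
  · refine (meas_ge_le_lintegral_div (Finset.measurable_sum _ fun i _ => hm i).aemeasurable
      (by simpa using hr) ENNReal.ofReal_ne_top).trans ?_
    gcongr
    rw [lintegral_finsetSum _ fun i _ => hm i]
    refine (Finset.sum_le_sum fun i _ =>
      lintegral_enorm_armaProcess_sub_le φ ξ G N ((i.val : ℤ) + 1)).trans ?_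
    simp


lemma IsMixture.pow_smul_armaTruncation_le {F H G : ProbabilityMeasure ℝ} {δ : ℝ}
    (hG : IsMixture F H δ G) (N n : ℕ) :
    ENNReal.ofReal (1 - δ) ^ (Finset.Icc (-(N : ℤ)) n).card •
      (Measure.infinitePi fun _ : ℤ => (F : Measure ℝ)).map
        (fun v (i : Fin n) => armaTruncation φ ξ N ((i.val : ℤ) + 1) v) ≤
      (Measure.infinitePi fun _ : ℤ => (G : Measure ℝ)).map
        (fun v (i : Fin n) => armaTruncation φ ξ N ((i.val : ℤ) + 1) v) :=
  pow_smul_map_infinitePi_le hG.smul_le (measurable_armaTruncation_vec φ ξ N n) _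
    fun _ _ h => funext fun i => armaTruncation_congr φ ξ h i

lemma lintegral_enorm_gaussLaw_le {τ : ℝ} (hτ : τ ∈ Ioc (0 : ℝ) 1) :
    ∫⁻ x, ‖x‖ₑ ∂(gaussLaw 0 τ : Measure ℝ) ≤ ∫⁻ x, ‖x‖ₑ ∂gaussianReal 0 1 := by
  rw [toMeasure_gaussLaw, lintegral_map (by fun_prop) (by fun_prop)]
  refine lintegral_mono fun x => ?_
  rw [zero_add, enorm_mul]
  refine mul_le_of_le_one_left zero_le ?_
  rw [← ofReal_norm, Real.norm_of_nonneg hτ.1.le]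
  exact ENNReal.ofReal_le_one.2 hτ.2

variable {φ ξ}

/-- A small contamination of the innovations changes the probability that the observations fall
into a given closed set by little, even though infinitely many innovations are involved. -/
lemma ArmaRegular.exists_law_le (h : ArmaRegular φ ξ) {F : ProbabilityMeasure ℝ}
    (hF : Integrable id (F : Measure ℝ)) {n : ℕ} {D : Set (Fin n → ℝ)} (hD : IsClosed D) {η : ℝ}
    (hη : 0 < η) : ∃ δ₀ > (0 : ℝ), ∀ δ ∈ Ioc (0 : ℝ) 1, δ ≤ δ₀ → ∀ τ ∈ Ioc (0 : ℝ) 1, ∀ G,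
      IsMixture F (gaussLaw 0 τ) δ G →
      ((armaModel φ ξ).law G n : Measure (Fin n → ℝ)).real D ≤
        ((armaModel φ ξ).law F n : Measure (Fin n → ℝ)).real D + η := by
  set X : (ℤ → ℝ) → Fin n → ℝ := fun v i => armaProcess φ ξ ((i.val : ℤ) + 1) v with hX
  have hXm : Measurable X := measurable_armaProcess_vec φ ξ n
  -- A bound for the first absolute moment of `F` and of every admissible mixture, independent of
  -- `δ` and `τ`; the truncation point `N` can thus be chosen before them.
  set m : ℝ≥0∞ := ∫⁻ x, ‖x‖ₑ ∂(F : Measure ℝ) + ∫⁻ x, ‖x‖ₑ ∂gaussianReal 0 1 with hm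
  have hm_top : m ≠ ∞ := by
    refine ENNReal.add_ne_top.2 ⟨hF.2.ne, ?_⟩
    exact ((memLp_id_gaussianReal (μ := 0) (v := 1) 1).integrable le_rfl).2.ne
  -- The margin `r` is used twice, in passing from the process to its truncation under `G` and back
  -- under `F`. The thickening and the three steps `e1`, `e2`, `e3` cost `η / 4` each.
  have hr : ∃ r > 0, ((armaModel φ ξ).law F n : Measure (Fin n → ℝ)).real
      (Metric.cthickening (r + r) D) <
      ((armaModel φ ξ).law F n : Measure (Fin n → ℝ)).real D + η / 4 := by
    have h1 := tendsto_measure_cthickening_of_isClosed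
      (μ := ((armaModel φ ξ).law F n : Measure (Fin n → ℝ))) ⟨1, one_pos, measure_ne_top _ _⟩ hD
    have h2 := (ENNReal.tendsto_toReal (measure_ne_top _ _)).comp h1
    have h3 : Tendsto (fun r : ℝ => r + r) (𝓝[>] 0) (𝓝 0) :=
      Tendsto.mono_left (Continuous.tendsto' (by fun_prop) _ _ (by simp)) nhdsWithin_le_nhds
    have h4 := (h2.comp h3).eventually_lt_const (lt_add_of_pos_right _ (by positivity : 0 < η / 4))
    obtain ⟨r, hr, hr0⟩ := (h4.and self_mem_nhdsWithin).exists
    exact ⟨r, hr0, hr⟩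
  obtain ⟨r, hr0, hr⟩ := hr
  have hN : ∃ N : ℕ, n * ((∑' j : ℕ, ‖PowerSeries.coeff (j + N)
      (lagInv φ * (lagPoly ξ : PowerSeries ℝ))‖ₑ) * m) / ENNReal.ofReal r <
        ENNReal.ofReal (η / 4) := by
    have hc : ∑' j : ℕ, ‖PowerSeries.coeff j (lagInv φ * (lagPoly ξ : PowerSeries ℝ))‖ₑ ≠ ∞ := by
      have := h.summable_coeff.tsum_ofReal_ne_top
      simpa only [ofReal_norm] using this
    have h1 := ENNReal.tendsto_sum_nat_add _ hc
    have h2 := ENNReal.Tendsto.mul_const (b := m) h1 (Or.inr hm_top)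
    have h3 := ENNReal.Tendsto.const_mul (a := (n : ℝ≥0∞)) h2 (Or.inr (ENNReal.natCast_ne_top n))
    have h4 := ENNReal.Tendsto.div_const (b := ENNReal.ofReal r) h3
      (Or.inr (by simpa using hr0))
    rw [zero_mul, mul_zero, ENNReal.zero_div] at h4
    exact (h4.eventually_lt_const (by simpa using hη)).exists
  obtain ⟨N, hN⟩ := hN
  set T : (ℤ → ℝ) → Fin n → ℝ := fun v i => armaTruncation φ ξ N ((i.val : ℤ) + 1) v with hT
  have hTm : Measurable T := measurable_armaTruncation_vec φ ξ N n
  have hdist : ∀ P : ProbabilityMeasure ℝ, ∫⁻ x, ‖x‖ₑ ∂(P : Measure ℝ) ≤ m →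
      (Measure.infinitePi fun _ : ℤ => (P : Measure ℝ)).real {v | r < dist (X v) (T v)} ≤
        η / 4 := by
    intro P hP
    refine ENNReal.toReal_le_of_le_ofReal (by positivity) ?_
    refine (measure_dist_armaProcess_gt_le φ ξ P N n hr0).trans (le_trans ?_ hN.le)
    gcongr
  set k := (Finset.Icc (-(N : ℤ)) n).card
  refine ⟨η / 4 / (k + 1), by positivity, fun δ hδ hδ₀ τ hτ G hG => ?_⟩
  have hGm : ∫⁻ x, ‖x‖ₑ ∂(G : Measure ℝ) ≤ m := by
    rw [hG, lintegral_add_measure, lintegral_smul_measure, lintegral_smul_measure]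
    refine add_le_add (mul_le_of_le_one_left zero_le ?_)
      ((mul_le_of_le_one_left zero_le ?_).trans (lintegral_enorm_gaussLaw_le hτ))
    · exact ENNReal.ofReal_le_one.2 (by linarith [hδ.1])
    · exact ENNReal.ofReal_le_one.2 hδ.2
  have hδ0 : 0 ≤ 1 - δ := by linarith [hδ.2]
  have hE : MeasurableSet (Metric.cthickening r D) := Metric.isClosed_cthickening.measurableSet
  have hE2 : MeasurableSet (Metric.cthickening (r + r) D) :=
    Metric.isClosed_cthickening.measurableSet
  set PF := Measure.infinitePi fun _ : ℤ => (F : Measure ℝ)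
  set PG := Measure.infinitePi fun _ : ℤ => (G : Measure ℝ)
  have e1 : PG.real (X ⁻¹' D) ≤ PG.real (T ⁻¹' Metric.cthickening r D) + η / 4 := by
    refine (measureReal_mono (s₂ := T ⁻¹' Metric.cthickening r D ∪ {v | r < dist (X v) (T v)})
      fun v hv => ?_).trans ((measureReal_union_le _ _).trans
        (add_le_add le_rfl (hdist G hGm)))
    by_cases hd : r < dist (X v) (T v)
    · exact Or.inr hd
    · exact Or.inl (Metric.mem_cthickening_of_dist_le _ _ _ _ hv (by
        rw [dist_comm]; exact not_lt.1 hd))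
  have e2 : PG.real (T ⁻¹' Metric.cthickening r D) ≤
      PF.real (T ⁻¹' Metric.cthickening r D) + η / 4 := by
    have h1 := hG.pow_smul_armaTruncation_le φ ξ N n
    rw [← ENNReal.ofReal_pow hδ0] at h1
    have : IsProbabilityMeasure (PF.map T) := Measure.isProbabilityMeasure_map hTm.aemeasurable
    have : IsProbabilityMeasure (PG.map T) := Measure.isProbabilityMeasure_map hTm.aemeasurable
    have h2 := measureReal_le_add_of_smul_le (μ := PF.map T) (ν := PG.map T)
      ⟨pow_nonneg hδ0 k, pow_le_one₀ hδ0 (by linarith [hδ.1])⟩ h1 hE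
    rw [map_measureReal_apply hTm hE, map_measureReal_apply hTm hE] at h2
    linarith [one_sub_pow_le k ⟨hδ.1.le, hδ.2⟩ hδ₀]
  have e3 : PF.real (T ⁻¹' Metric.cthickening r D) ≤
      PF.real (X ⁻¹' Metric.cthickening (r + r) D) + η / 4 := by
    refine (measureReal_mono (s₂ := X ⁻¹' Metric.cthickening (r + r) D ∪
      {v | r < dist (X v) (T v)}) fun v hv => ?_).trans ((measureReal_union_le _ _).trans
        (add_le_add le_rfl (hdist F le_self_add)))
    by_cases hd : r < dist (X v) (T v)
    · exact Or.inr hd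
    · exact Or.inl (Metric.cthickening_cthickening_subset hr0.le hr0.le D
        (Metric.mem_cthickening_of_dist_le _ _ _ _ hv (not_lt.1 hd)))
  simp only [toMeasure_armaModel_law] at hr ⊢
  rw [map_measureReal_apply hXm hE2, map_measureReal_apply hXm hD.measurableSet] at hr
  rw [map_measureReal_apply hXm hD.measurableSet, map_measureReal_apply hXm hD.measurableSet]
  linarith

/-- A moving average involves finitely many innovations only. -/
lemma armaProcess_eq_armaTruncation {q : ℕ} (φ : Fin 0 → ℝ) (ξ : Fin q → ℝ) (t : ℤ)
    (v : ℤ → ℝ) : armaProcess φ ξ t v =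
      armaTruncation φ ξ ((lagPoly ξ).natDegree + 1) t v := by
  unfold armaProcess armaTruncation
  refine tsum_eq_sum fun j hj => ?_
  have h1 : lagInv φ = 1 := by simp [lagInv, lagPoly]
  rw [h1, one_mul, Polynomial.coeff_coe, Polynomial.coeff_eq_zero_of_natDegree_lt, zero_mul]
  simpa using hj

/-! ### The ARMA model -/

lemma armaModel_mixture_mem {F H G : ProbabilityMeasure ℝ} {δ : ℝ} (hδ : δ ∈ Icc (0 : ℝ) 1)
    (hG : IsMixture F H δ G) (hF : F ∈ (armaModel φ ξ).errors)
    (hH : H ∈ (armaModel φ ξ).errors) : G ∈ (armaModel φ ξ).errors := by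
  obtain ⟨hF1, hF2, hF3, hF4⟩ := hF
  obtain ⟨hH1, hH2, hH3, hH4⟩ := hH
  refine ⟨fisherInfoLoc_mixture_lt_top hδ hG hF1 hH1, ?_, ?_, ?_⟩
  · rw [memLp_two_iff_integrable_sq aestronglyMeasurable_id]
    exact hG.integrable hF2.integrable_sq hH2.integrable_sq
  · rw [hG.integral_eq hδ (f := fun v => v) (hF2.integrable one_le_two) (hH2.integrable one_le_two), hF3, hH3]
    simp
  · rw [hG.integral_eq hδ (f := fun v => v ^ 2) hF2.integrable_sq hH2.integrable_sq]
    rcases hδ.1.eq_or_lt with h | h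
    · simpa [← h] using hF4
    · exact add_pos_of_nonneg_of_pos (mul_nonneg (by linarith [hδ.2]) hF4.le) (mul_pos h hH4)

lemma gaussLaw_mem_armaModel_errors {τ : ℝ} (hτ : 0 < τ) :
    gaussLaw 0 τ ∈ (armaModel φ ξ).errors := by
  refine ⟨fisherInfoLoc_gaussLaw_lt_top 0 hτ, ?_, ?_, ?_⟩
  · rw [toMeasure_gaussLaw, memLp_map_measure_iff aestronglyMeasurable_id (by fun_prop)]
    simpa [Function.comp_def] using (memLp_id_gaussianReal (μ := 0) (v := 1) 2).const_mul τ
  · rw [integral_gaussLaw 0 τ continuous_id']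
    simp only [zero_add]
    rw [integral_const_mul, integral_id_gaussianReal, mul_zero]
  · rw [integral_gaussLaw 0 τ (by fun_prop : Continuous fun v : ℝ => v ^ 2)]
    simp only [zero_add, mul_pow, integral_const_mul]
    have := variance_id_gaussianReal (μ := 0) (v := 1)
    rw [variance_of_integral_eq_zero (by fun_prop) (by simp [integral_id_gaussianReal])] at this
    simp only [id] at this
    rw [this]
    simpa using pow_pos hτ 2

/-- The variance factor cannot offset the growth of the information of location: for `δ ≤ 1 / 2` the
second moment of `G` is at least half that of `F`. -/
lemma exists_gaussLaw_le_armaModel_info {F : ProbabilityMeasure ℝ}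
    (hF : F ∈ (armaModel φ ξ).errors) {δ : ℝ} (hδ : δ ∈ Ioc (0 : ℝ) (1 / 2)) (B : ℝ) :
    ∃ τ ∈ Ioc (0 : ℝ) 1, ∀ G, IsMixture F (gaussLaw 0 τ) δ G →
      B ≤ (fisherInfoLoc G).toReal * ∫ v, v ^ 2 ∂(G : Measure ℝ) := by
  obtain ⟨hF1, hF2, hF3, hF4⟩ := hF
  have hδ1 : δ ≤ 1 := by linarith [hδ.2]
  set s := ∫ v, v ^ 2 ∂(F : Measure ℝ)
  obtain ⟨τ, hτ, h⟩ := exists_gaussLaw_le_fisherInfoLoc hF1 ⟨hδ.1, hδ1⟩ (max B 0 / (s / 2))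
  refine ⟨τ, hτ, fun G hG => ?_⟩
  obtain ⟨-, hH2, -, hH4⟩ := gaussLaw_mem_armaModel_errors (φ := φ) (ξ := ξ) hτ.1
  have h1 : s / 2 ≤ ∫ v, v ^ 2 ∂(G : Measure ℝ) := by
    rw [hG.integral_eq (f := fun v => v ^ 2) ⟨hδ.1.le, hδ1⟩ hF2.integrable_sq hH2.integrable_sq]
    have e1 := mul_nonneg hδ.1.le hH4.le
    have e2 := mul_le_mul_of_nonneg_right (show 1 / 2 ≤ 1 - δ by linarith [hδ.2]) hF4.le
    linarith
  calc B ≤ max B 0 / (s / 2) * (s / 2) := by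
        rw [div_mul_cancel₀ _ (by positivity)]; exact le_max_left _ _
    _ ≤ (fisherInfoLoc G).toReal * ∫ v, v ^ 2 ∂(G : Measure ℝ) :=
        mul_le_mul (h G hG) h1 (by positivity) ENNReal.toReal_nonneg

theorem ArmaRegular.nonuniform_armaModel (h : ArmaRegular φ ξ) {F : ProbabilityMeasure ℝ}
    (hF : F ∈ (armaModel φ ξ).errors) {S : (n : ℕ) → (Fin n → ℝ) → Fin p ⊕ Fin q → ℝ}
    (hS : ∀ n, Measurable (S n)) (hSc : 1 ≤ p → ∀ n, Continuous (S n))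
    (hN : (armaModel φ ξ).AsymptoticallyNormal F S) : (armaModel φ ξ).Nonuniform F S := by
  refine ErrorModel.nonuniform_of_contaminable hS (A := armaMatrix φ ξ)
    (lam := fun G => (fisherInfoLoc G).toReal * ∫ v, v ^ 2 ∂(G : Measure ℝ)) (fun _ => rfl)
    (mul_nonneg ENNReal.toReal_nonneg hF.2.2.2.le)
    (fun H hH δ hδ G hG => armaModel_mixture_mem hδ hG hF hH) (fun n u => ?_) hN
  -- A moving average involves finitely many innovations, so every measurable event is handled by
  -- domination. Otherwise infinitely many may enter, for which `(1 - δ)^m` degenerates, and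
  -- closedness of the event replaces domination.
  rcases Nat.eq_zero_or_pos p with rfl | hp
  · refine ErrorModel.contaminable_of_smul_le
      (ErrorModel.measurable_standardized _ F (hS n) measurableSet_Iic)
      (Finset.Icc (-(((lagPoly ξ).natDegree + 1 : ℕ) : ℤ)) n).card
      (fun H G δ hG => ?_) fun δ hδ B => ?_
    · have := hG.pow_smul_armaTruncation_le φ ξ ((lagPoly ξ).natDegree + 1) n
      simpa only [toMeasure_armaModel_law, armaProcess_eq_armaTruncation] using this
    · obtain ⟨τ, hτ, h⟩ := exists_gaussLaw_le_armaModel_info hF hδ B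
      exact ⟨_, gaussLaw_mem_armaModel_errors hτ.1, isSymmetricLaw_gaussLaw τ, h⟩
  · intro B η hη
    obtain ⟨δ₀, hδ₀, hlaw⟩ := h.exists_law_le (hF.2.1.integrable one_le_two)
      (isClosed_Iic.preimage ((armaModel φ ξ).continuous_standardized F (hSc hp n)))
      hη (D := (armaModel φ ξ).standardized F (S n) ⁻¹' Iic u)
    refine ⟨min δ₀ (1 / 2), by positivity, fun δ hδ hδm => ?_⟩
    obtain ⟨τ, hτ, h⟩ :=
      exists_gaussLaw_le_armaModel_info hF ⟨hδ.1, hδm.trans (min_le_right _ _)⟩ B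
    exact ⟨_, gaussLaw_mem_armaModel_errors hτ.1, isSymmetricLaw_gaussLaw τ, fun G hG =>
      ⟨h G hG, hlaw δ hδ (hδm.trans (min_le_left _ _)) τ hτ G hG⟩⟩

end Arma

theorem mainTheorem6 :
    -- location
    (∀ (θ : ℝ), ∀ F ∈ (locationModel θ).errors,
      ∀ S : (n : ℕ) → (Fin n → ℝ) → Fin 1 → ℝ, (∀ n, Measurable (S n)) →
        (locationModel θ).AsymptoticallyNormal F S → (locationModel θ).Nonuniform F S) ∧
    -- scale
    (∀ (σ : ℝ), 0 < σ → ∀ F ∈ (scaleModel σ).errors,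
      ∀ S : (n : ℕ) → (Fin n → ℝ) → Fin 1 → ℝ, (∀ n, Measurable (S n)) →
        (scaleModel σ).AsymptoticallyNormal F S → (scaleModel σ).Nonuniform F S) ∧
    -- linear regression
    (∀ (d : ℕ) (K : ProbabilityMeasure (Fin d → ℝ)),
      MemLp id 2 (K : Measure (Fin d → ℝ)) → (secondMoment K).PosDef →
      ∀ (θ : Fin d → ℝ), ∀ F ∈ (regressionModel K θ).errors,
      ∀ S : (n : ℕ) → (Fin n → (Fin d → ℝ) × ℝ) → Fin d → ℝ, (∀ n, Measurable (S n)) →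
        (regressionModel K θ).AsymptoticallyNormal F S → (regressionModel K θ).Nonuniform F S) ∧
    -- MA (the case p = 0), AR and ARMA (the case p ≥ 1, in which S is to be continuous)
    (∀ (p q : ℕ) (φ : Fin p → ℝ) (ξ : Fin q → ℝ), ArmaRegular φ ξ →
      ∀ F ∈ (armaModel φ ξ).errors,
      ∀ S : (n : ℕ) → (Fin n → ℝ) → Fin p ⊕ Fin q → ℝ, (∀ n, Measurable (S n)) →
        (1 ≤ p → ∀ n, Continuous (S n)) →
        (armaModel φ ξ).AsymptoticallyNormal F S → (armaModel φ ξ).Nonuniform F S) := by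
  exact ⟨fun θ _ hF _ hS hN => nonuniform_locationModel θ hF hS hN,
    fun σ _ _ hF _ hS hN => nonuniform_scaleModel σ hF hS hN,
    fun _ K _ _ θ _ hF _ hS hN => nonuniform_regressionModel K θ hF hS hN,
    fun _ _ _ _ h _ hF _ hS hSc hN => h.nonuniform_armaModel hF hS hSc hN⟩
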